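/- A set partition of a finite set $S\subset\mathbb Z$ is a set $\Lambda$ of nonempty, pairwise disjoint blocks with union $S$. An arc of $\Lambda$ is a pair $(i,j)$ of elements of one block such that $j$ is the least element of that block greater than $i$. Let $\mathrm{Arc}(\Lambda)$ be the set of arcs and $\mathrm{Cov}(\Lambda)$ the set of arcs of the form $(i,i+1)$. Write $[n]=\{1,\dots,n\}$ and $[\pm n]=\{\pm1,\dots,\pm n\}$. Let $\Pi(n)$ be the set of all set partitions of $[n]$. Let $\Pi^{B}(n)$ (respectively $\Pi^{D}(n)$) be the set of all set partitions $\Lambda$ of $\{0\}\cup[\pm n]$ (respectively of $[\pm n]$) such that $(i,j)\in\mathrm{Arc}(\Lambda)$ if and only if $(-j,-i)\in\mathrm{Arc}(\Lambda)$, and such that no arc has the form $(-i,i)$. For such $\Lambda$, both $|\mathrm{Arc}(\Lambda)|$ and $|\mathrm{Cov}(\Lambda)|$ are even. For $X\in\{B,D\}$ let $\widetilde{NC}^{X}(n)$ be the set of $\Lambda\in\Pi^{X}(n)$ such that whenever $(i,k),(j,l)\in\mathrm{Arc}(\Lambda)$ and $i<j<k<l$, then $(i,k)=(-l,-j)$.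 A set partition is feasible if each block has at least two elements, poor if each block has at most two elements, B-feasible if no block contains exactly one nonzero element, and B-poor if no block contains more than two nonzero elements. Define the polynomials $$\mathrm{Bell}_n(x)=\sum_{\Lambda\in\Pi(n)}x^{|\mathrm{Arc}(\Lambda)|},\qquad F_n(x)=\sum_{\text{feasible }\Lambda\in\Pi(n)}x^{|\mathrm{Arc}(\Lambda)|},$$ $$\mathrm{Bell}^X_n(x,y)=\sum_{\Lambda\in\Pi^X(n)}x^{\frac{|\mathrm{Arc}(\Lambda)|}2}\left(\tfrac yx\right)^{\frac{|\mathrm{Cov}(\Lambda)|}2},\qquad \mathrm{Cat}^X_n(x,y)=\sum_{\Lambda\in\widetilde{NC}^X(n)}x^{\frac{|\mathrm{Arc}(\Lambda)|}2}\left(\tfrac yx\right)^{\frac{|\mathrm{Cov}(\Lambda)|}2},$$ $$\widetilde F^B_n(x)=\sum_{\text{B-feasible }\Lambda\in\Pi^B(n)}x^{\frac{|\mathrm{Arc}(\Lambda)|}2},\qquad M^B_n(x)=\sum_{\text{poor }\Lambda\in\widetilde{NC}^B(n)}x^{\frac{|\mathrm{Arc}(\Lambda)|}2},\qquad \widetilde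 M^B_n(x)=\sum_{\text{B-poor }\Lambda\in\widetilde{NC}^B(n)}x^{\frac{|\mathrm{Arc}(\Lambda)|}2},$$ and $\mathrm{Bell}^B_n(x)=\mathrm{Bell}^B_n(x,x)$. **Theorem 6.3.** For every integer $n\ge 0$ the following polynomial identities hold. 1. $\displaystyle \mathrm{Bell}^B_n(x,y)=\sum_{k=0}^n\binom nk\mathrm{Bell}_k(2x)\,y^{n-k}=\sum_{k=0}^n\binom nk F_k(2x)\,(y+1)^{n-k}.$ 2. $\displaystyle \mathrm{Bell}^D_{n+1}(x,y)=\sum_{k=0}^n\binom nk\mathrm{Bell}^B_k(x)\,y^{n-k}=\sum_{k=0}^n\binom nk\widetilde F^B_k(x)\,(y+1)^{n-k}.$ 3. $\displaystyle \mathrm{Cat}^B_n(x,y)=\sum_{k=0}^n\binom nk M^B_k(x)\,y^{n-k}=\sum_{k=0}^{\lfloor n/2\rfloor}\binom{2k}k\binom n{2k}x^k(y+1)^{n-2k}.$ 4. $\displaystyle \mathrm{Cat}^D_{n+1}(x,y)=\sum_{k=0}^n\binom nk\widetilde M^B_k(x)\,y^{n-k}=\sum_{k=0}^n\binom nk\binom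 k{\lfloor k/2\rfloor}x^{\lceil k/2\rceil}(y+1)^{n-k}.$ Moreover $\mathrm{Cat}^B_n(x,x)=\sum_{k=0}^n\binom nk^2x^k$, so that setting $x=y$ in part 3 gives Riordan's identity $$\sum_{k=0}^n\binom nk^2x^k=\sum_{k=0}^{\lfloor n/2\rfloor}\binom{2k}k\binom n{2k}x^k(x+1)^{n-2k}.$$ -/

import Mathlib

noncomputable section

namespace SetPart

/-- The set `[n] = {1, …, n}`, as a set of integers. -/
def groundA (n : ℕ) : Finset ℤ := Finset.Icc 1 (n : ℤ)

/-- The set `{0} ∪ [±n] = {-n, …, -1, 0, 1, …, n}`. -/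
def groundB (n : ℕ) : Finset ℤ := Finset.Icc (-(n : ℤ)) (n : ℤ)

/-- The set `[±n] = {-n, …, -1, 1, …, n}`. -/
def groundD (n : ℕ) : Finset ℤ := (groundB n).erase 0

variable {s : Finset ℤ}

/-- `Arc(Λ)`: the pairs `(i, j)` with `i < j` in a common block of `Λ` such that `j` is the least
element greater than `i` of that block. -/
def arcs (Λ : Finpartition s) : Finset (ℤ × ℤ) :=
  (s ×ˢ s).filter fun a =>
    a.1 < a.2 ∧ ∃ b ∈ Λ.parts, a.1 ∈ b ∧ a.2 ∈ b ∧ ∀ k ∈ b, a.1 < k → a.2 ≤ k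

/-- `Cov(Λ)`: the arcs of the form `(i, i + 1)`. -/
def covs (Λ : Finpartition s) : Finset (ℤ × ℤ) :=
  (arcs Λ).filter fun a => a.2 = a.1 + 1

/-- The defining property of the type B and type D set partitions: the arc set is invariant under
`(i, j) ↦ (-j, -i)` and there is no arc of the form `(-i, i)`. (Such an arc would have to carry a
label equal to its own negative.) -/
def IsSigned (Λ : Finpartition s) : Prop :=
  ∀ a ∈ arcs Λ, (-a.2, -a.1) ∈ arcs Λ ∧ a.1 ≠ -a.2

/-- The weak noncrossing property of types B and D: the only crossings allowed are between an
arc `(j, l)` and its mirror image `(-l, -j)`. -/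
def IsWeaklyNoncrossing (Λ : Finpartition s) : Prop :=
  ∀ a ∈ arcs Λ, ∀ b ∈ arcs Λ, a.1 < b.1 → b.1 < a.2 → a.2 < b.2 → a = (-b.2, -b.1)

/-- Every block has at least two elements. -/
def IsFeasible (Λ : Finpartition s) : Prop := ∀ b ∈ Λ.parts, 2 ≤ b.card

/-- Every block has at most two elements. -/
def IsPoor (Λ : Finpartition s) : Prop := ∀ b ∈ Λ.parts, b.card ≤ 2

/-- No block contains exactly one nonzero element. -/
def IsBFeasible (Λ : Finpartition s) : Prop := ∀ b ∈ Λ.parts, (b.erase 0).card ≠ 1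

/-- No block contains more than two nonzero elements. -/
def IsBPoor (Λ : Finpartition s) : Prop := ∀ b ∈ Λ.parts, (b.erase 0).card ≤ 2

instance (Λ : Finpartition s) : Decidable (IsSigned Λ) :=
  inferInstanceAs (Decidable (∀ a ∈ arcs Λ, (-a.2, -a.1) ∈ arcs Λ ∧ a.1 ≠ -a.2))

instance (Λ : Finpartition s) : Decidable (IsWeaklyNoncrossing Λ) :=
  inferInstanceAs (Decidable (∀ a ∈ arcs Λ, ∀ b ∈ arcs Λ,
    a.1 < b.1 → b.1 < a.2 → a.2 < b.2 → a = (-b.2, -b.1)))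

instance (Λ : Finpartition s) : Decidable (IsFeasible Λ) :=
  inferInstanceAs (Decidable (∀ b ∈ Λ.parts, 2 ≤ b.card))

instance (Λ : Finpartition s) : Decidable (IsPoor Λ) :=
  inferInstanceAs (Decidable (∀ b ∈ Λ.parts, b.card ≤ 2))

instance (Λ : Finpartition s) : Decidable (IsBFeasible Λ) :=
  inferInstanceAs (Decidable (∀ b ∈ Λ.parts, (b.erase 0).card ≠ 1))

instance (Λ : Finpartition s) : Decidable (IsBPoor Λ) :=
  inferInstanceAs (Decidable (∀ b ∈ Λ.parts, (b.erase 0).card ≤ 2))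

/-- `Π^B(n)`: the type B set partitions, of `{0} ∪ [±n]`. -/
def piB (n : ℕ) : Finset (Finpartition (groundB n)) :=
  Finset.univ.filter fun Λ => IsSigned Λ

/-- `Π^D(n)`: the type D set partitions, of `[±n]`. -/
def piD (n : ℕ) : Finset (Finpartition (groundD n)) :=
  Finset.univ.filter fun Λ => IsSigned Λ

/-- The weakly noncrossing elements of `Π^B(n)`. -/
def ncB (n : ℕ) : Finset (Finpartition (groundB n)) :=
  (piB n).filter fun Λ => IsWeaklyNoncrossing Λ

/-- The weakly noncrossing elements of `Π^D(n)`. -/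
def ncD (n : ℕ) : Finset (Finpartition (groundD n)) :=
  (piD n).filter fun Λ => IsWeaklyNoncrossing Λ

section polynomials

variable {R : Type*} [CommRing R]

/-- The weight `x ^ (|Arc(Λ)| / 2) * (y / x) ^ (|Cov(Λ)| / 2)`, written without division. Both
halved numbers are integers on type B and type D partitions: see `even_card_arcs_sdiff_covs` and
`even_card_covs` below. -/
def weight (Λ : Finpartition s) (x y : R) : R :=
  x ^ ((arcs Λ \ covs Λ).card / 2) * y ^ ((covs Λ).card / 2)

/-- `Bell_n(x) = ∑ x ^ |Arc(Λ)|` over all set partitions of `[n]`. -/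
def bell (n : ℕ) (x : R) : R := ∑ Λ : Finpartition (groundA n), x ^ (arcs Λ).card

/-- `F_n(x)`: the sum of `x ^ |Arc(Λ)|` over the feasible set partitions of `[n]`. -/
def feasible (n : ℕ) (x : R) : R :=
  ∑ Λ : Finpartition (groundA n) with IsFeasible Λ, x ^ (arcs Λ).card

/-- `Bell^B_n(x, y)`. -/
def bellB (n : ℕ) (x y : R) : R := ∑ Λ ∈ piB n, weight Λ x y

/-- `Bell^D_n(x, y)`. -/
def bellD (n : ℕ) (x y : R) : R := ∑ Λ ∈ piD n, weight Λ x y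

/-- `Cat^B_n(x, y)`. -/
def catB (n : ℕ) (x y : R) : R := ∑ Λ ∈ ncB n, weight Λ x y

/-- `Cat^D_n(x, y)`. -/
def catD (n : ℕ) (x y : R) : R := ∑ Λ ∈ ncD n, weight Λ x y

/-- The sum of `x ^ (|Arc(Λ)| / 2)` over the B-feasible elements of `Π^B(n)`. -/
def bFeasibleB (n : ℕ) (x : R) : R :=
  ∑ Λ ∈ piB n with IsBFeasible Λ, x ^ ((arcs Λ).card / 2)

/-- `M^B_n(x)`: the sum of `x ^ (|Arc(Λ)| / 2)` over the poor weakly noncrossing elements of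
`Π^B(n)`. -/
def motzkinB (n : ℕ) (x : R) : R :=
  ∑ Λ ∈ ncB n with IsPoor Λ, x ^ ((arcs Λ).card / 2)

/-- The sum of `x ^ (|Arc(Λ)| / 2)` over the B-poor weakly noncrossing elements of `Π^B(n)`. -/
def bMotzkinB (n : ℕ) (x : R) : R :=
  ∑ Λ ∈ ncB n with IsBPoor Λ, x ^ ((arcs Λ).card / 2)

end polynomials

theorem even_card_of_mirror (S : Finset (ℤ × ℤ))
    (h : ∀ a ∈ S, (-a.2, -a.1) ∈ S ∧ a.1 ≠ -a.2) : Even S.card := by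
  have key : ∑ _a ∈ S, (1 : ZMod 2) = 0 := by
    refine Finset.sum_involution (fun a _ => (-a.2, -a.1)) ?_ ?_ ?_ ?_
    · intro a _
      decide
    · intro a ha _ he
      exact (h a ha).2 (congrArg Prod.fst he).symm
    · intro a ha
      exact (h a ha).1
    · intro a _
      simp
  rw [Finset.sum_const, nsmul_eq_mul, mul_one] at key
  exact (ZMod.natCast_eq_zero_iff_even).1 key

theorem even_card_arcs {Λ : Finpartition s} (h : IsSigned Λ) : Even (arcs Λ).card :=
  even_card_of_mirror _ h

theorem even_card_covs {Λ : Finpartition s} (h : IsSigned Λ) : Even (covs Λ).card := by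
  refine even_card_of_mirror _ fun a ha => ?_
  rw [covs, Finset.mem_filter] at ha ⊢
  refine ⟨⟨(h a ha.1).1, ?_⟩, (h a ha.1).2⟩
  have := ha.2
  dsimp only
  omega

theorem even_card_arcs_sdiff_covs {Λ : Finpartition s} (h : IsSigned Λ) :
    Even (arcs Λ \ covs Λ).card := by
  rw [Finset.card_sdiff_of_subset (show covs Λ ⊆ arcs Λ from Finset.filter_subset _ _)]
  exact (even_card_arcs h).tsub (even_card_covs h)

end SetPart

end

noncomputable section

namespace SetPart

open Finset Relation

/-! A set partition is determined by its arcs, and the arc sets are exactly the sets of increasing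
pairs with distinct left ends and distinct right ends (`arcs_injective`, `exists_arcs_eq`). Such
sets can be grown from the inside out. A new largest element `a` either stays without an arc or
closes an arc `(i, a)` at some `i` that is not yet a left end; in the signed case the elements `±a`
arrive together and the arc comes with its mirror image. Each generating function therefore has the
form `(T ^ n) f` evaluated at an initial state, where `T` is a linear operator on functions of a
small statistic of the current arc set.

Quite different families turn out to share an operator. With `bellOp`, the statistic is (isolated
points, twice the number of nontrivial block maxima) for partitions of `[n]` weighted by `2x`, and
(pairs `±i` of free rows, other free rows) for signed partitions. With `ncOp`, the statistic
describes the visible rows of all weakly noncrossing partitions, or the visible pairs `±i` of the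
poor ones. Keeping track of covers only adds the scalar `y`: the one cover available at each step is
the arc from the current maximum to `a`, and it leaves the statistic unchanged. So the refined
polynomials come from `T + y`, and since `y` commutes with `T`, the binomial theorem
(`pow_add_smul_apply`) gives the first formula of each part.

For the second formulas, let `B` be the binomial transform in the first variable. It satisfies
`bellOp ∘ B = B ∘ (bellOp + 1)` and `ncOp ∘ B = B ∘ (walkOp + 1)`, it sends the indicator of `0` to
the constant `1`, and it does nothing at the argument `0`. Hence `y` becomes `y + 1` and the
constant end condition becomes "end at `0`" (`countOp_pow_eq_sum_delta`, `ncOp_pow_eq_sum_walkOp`).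
For `bellOp` this end condition is feasibility; for `walkOp` it leaves weighted lattice walks,
counted in closed form by `walkOp_pow_deltaLeft`. Riordan's identity is proved separately by
comparing polynomial coefficients, and the value of `Cat^B` at `x = y` is deduced from it. -/

/-! ### Set partitions encoded by their arc sets. -/

/-- The sets of pairs that are the arc set of some set partition of `s`. -/
def IsArcSet (s : Finset ℤ) (A : Finset (ℤ × ℤ)) : Prop :=
  (∀ a ∈ A, a.1 ∈ s ∧ a.2 ∈ s ∧ a.1 < a.2) ∧
    (∀ a ∈ A, ∀ b ∈ A, a.1 = b.1 → a.2 = b.2) ∧ ∀ a ∈ A, ∀ b ∈ A, a.2 = b.2 → a.1 = b.1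

theorem mem_arcs_iff {s : Finset ℤ} {Λ : Finpartition s} {i j : ℤ} :
    (i, j) ∈ arcs Λ ↔ i < j ∧ ∃ b ∈ Λ.parts, i ∈ b ∧ j ∈ b ∧ ∀ k ∈ b, i < k → j ≤ k := by
  simp only [arcs, mem_filter, mem_product]
  refine ⟨fun h => h.2, fun h => ⟨?_, h⟩⟩
  obtain ⟨-, b, hb, hi, hj, -⟩ := h
  exact ⟨Λ.le hb hi, Λ.le hb hj⟩

theorem isArcSet_arcs {s : Finset ℤ} (Λ : Finpartition s) : IsArcSet s (arcs Λ) := by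
  refine ⟨?_, ?_, ?_⟩
  · rintro ⟨i, j⟩ h
    obtain ⟨hij, b, hb, hi, hj, -⟩ := mem_arcs_iff.1 h
    exact ⟨Λ.le hb hi, Λ.le hb hj, hij⟩
  · rintro ⟨i, j⟩ h ⟨i', j'⟩ h' (rfl : i = i')
    obtain ⟨hij, b, hb, hi, hj, hm⟩ := mem_arcs_iff.1 h
    obtain ⟨hij', b', hb', hi', hj', hm'⟩ := mem_arcs_iff.1 h'
    obtain rfl := Λ.eq_of_mem_parts hb hb' hi hi'
    exact le_antisymm (hm _ hj' hij') (hm' _ hj hij)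
  · rintro ⟨i, j⟩ h ⟨i', j'⟩ h' (rfl : j = j')
    obtain ⟨hij, b, hb, hi, hj, hm⟩ := mem_arcs_iff.1 h
    obtain ⟨hij', b', hb', hi', hj', hm'⟩ := mem_arcs_iff.1 h'
    obtain rfl := Λ.eq_of_mem_parts hb hb' hj hj'
    rcases lt_trichotomy i i' with h | h | h
    · exact absurd (hm _ hi' h) (not_le.2 hij')
    · exact h
    · exact absurd (hm' _ hi h) (not_le.2 hij)

theorem exists_arc_right {s : Finset ℤ} {Λ : Finpartition s} {b : Finset ℤ} (hb : b ∈ Λ.parts)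
    {i j : ℤ} (hi : i ∈ b) (hj : j ∈ b) (hij : i < j) :
    ∃ k ∈ b, (i, k) ∈ arcs Λ ∧ k ≤ j := by
  obtain ⟨k, hk, hmin⟩ := exists_min_image (b.filter (i < ·)) id ⟨j, mem_filter.2 ⟨hj, hij⟩⟩
  rw [mem_filter] at hk
  exact ⟨k, hk.1, mem_arcs_iff.2 ⟨hk.2, b, hb, hi, hk.1, fun l hl hil =>
    hmin l (mem_filter.2 ⟨hl, hil⟩)⟩, hmin j (mem_filter.2 ⟨hj, hij⟩)⟩

theorem exists_arc_left {s : Finset ℤ} {Λ : Finpartition s} {b : Finset ℤ} (hb : b ∈ Λ.parts)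
    {i j : ℤ} (hi : i ∈ b) (hj : j ∈ b) (hij : i < j) :
    ∃ k ∈ b, (k, j) ∈ arcs Λ ∧ i ≤ k := by
  obtain ⟨k, hk, hmax⟩ := exists_max_image (b.filter (· < j)) id ⟨i, mem_filter.2 ⟨hi, hij⟩⟩
  rw [mem_filter] at hk
  refine ⟨k, hk.1, mem_arcs_iff.2 ⟨hk.2, b, hb, hk.1, hj, fun l hl hkl => ?_⟩,
    hmax i (mem_filter.2 ⟨hi, hij⟩)⟩
  by_contra hlj
  exact absurd (hmax l (mem_filter.2 ⟨hl, not_le.1 hlj⟩)) (not_le.2 hkl)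

theorem mem_of_arc_left {s : Finset ℤ} {Λ : Finpartition s} {b : Finset ℤ} (hb : b ∈ Λ.parts)
    {i j : ℤ} (h : (i, j) ∈ arcs Λ) (hi : i ∈ b) : j ∈ b := by
  obtain ⟨-, b', hb', hi', hj', -⟩ := mem_arcs_iff.1 h
  rwa [Λ.eq_of_mem_parts hb hb' hi hi']

theorem mem_of_arc_right {s : Finset ℤ} {Λ : Finpartition s} {b : Finset ℤ} (hb : b ∈ Λ.parts)
    {i j : ℤ} (h : (i, j) ∈ arcs Λ) (hj : j ∈ b) : i ∈ b := by
  obtain ⟨-, b', hb', hi', hj', -⟩ := mem_arcs_iff.1 h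
  rwa [Λ.eq_of_mem_parts hb hb' hj hj']

/-- Two elements of a block are joined by a chain of arcs, and every arc of the chain stays inside
one block of `Λ'`. The bound `m` on the distance drives the induction along the chain. -/
theorem mem_of_arcs_subset {s : Finset ℤ} {Λ Λ' : Finpartition s} (h : arcs Λ ⊆ arcs Λ')
    {b b' : Finset ℤ} (hb : b ∈ Λ.parts) (hb' : b' ∈ Λ'.parts) (m : ℕ) :
    ∀ i j : ℤ, i < j → (j - i).toNat ≤ m → i ∈ b → j ∈ b → (i ∈ b' ↔ j ∈ b') := by
  induction m with
  | zero => intro i j hij hm; omega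
  | succ m ih =>
    intro i j hij hm hi hj
    obtain ⟨k, hk, hik, hkj⟩ := exists_arc_right hb hi hj hij
    have hik' := h hik
    have h1 : i ∈ b' ↔ k ∈ b' := ⟨mem_of_arc_left hb' hik', mem_of_arc_right hb' hik'⟩
    have hlt := (mem_arcs_iff.1 hik).1
    rcases hkj.lt_or_eq with hkj | rfl
    · exact h1.trans (ih k j hkj (by omega) hk hj)
    · exact h1

theorem parts_subset_of_arcs_eq {s : Finset ℤ} {Λ Λ' : Finpartition s} (h : arcs Λ = arcs Λ') :
    Λ.parts ⊆ Λ'.parts := by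
  intro b hb
  obtain ⟨i, hi⟩ := Λ.nonempty_of_mem_parts hb
  obtain ⟨b', hb', hi'⟩ := Λ'.exists_mem (Λ.le hb hi)
  have key : b = b' := by
    ext j
    constructor
    · intro hj
      rcases lt_trichotomy i j with hij | rfl | hij
      · exact (mem_of_arcs_subset h.subset hb hb' _ i j hij le_rfl hi hj).1 hi'
      · exact hi'
      · exact (mem_of_arcs_subset h.subset hb hb' _ j i hij le_rfl hj hi).2 hi'
    · intro hj
      rcases lt_trichotomy i j with hij | rfl | hij
      · exact (mem_of_arcs_subset h.symm.subset hb' hb _ i j hij le_rfl hi' hj).1 hi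
      · exact hi
      · exact (mem_of_arcs_subset h.symm.subset hb' hb _ j i hij le_rfl hj hi').2 hi
  exact key ▸ hb'

theorem arcs_injective (s : Finset ℤ) : Function.Injective (arcs (s := s)) := fun _ _ h =>
  Finpartition.ext (Finset.Subset.antisymm (parts_subset_of_arcs_eq h)
    (parts_subset_of_arcs_eq h.symm))

theorem le_of_reflTransGen {A : Finset (ℤ × ℤ)} (hA : ∀ a ∈ A, a.1 < a.2) {i j : ℤ}
    (h : ReflTransGen (fun p q => (p, q) ∈ A) i j) : i ≤ j := by
  induction h with
  | refl => exact le_rfl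
  | tail _ hbc ih => exact ih.trans (hA _ hbc).le

-- The blocks are the chains of `A`. Two points are related when one is reachable from the other;
-- uniqueness of successors and of predecessors makes this comparability transitive, because two
-- paths with a common start or a common end are nested.
open Classical in
theorem exists_arcs_eq {s : Finset ℤ} {A : Finset (ℤ × ℤ)} (hA : IsArcSet s A) :
    ∃ Λ : Finpartition s, arcs Λ = A := by
  obtain ⟨h0, h1, h2⟩ := hA
  have hlt : ∀ a ∈ A, a.1 < a.2 := fun a ha => (h0 a ha).2.2
  set r : ℤ → ℤ → Prop := fun p q => (p, q) ∈ A with hr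
  have hU : Relator.RightUnique r := fun a b c hab hac => h1 _ hab _ hac rfl
  have hU' : Relator.RightUnique (Function.swap r) := fun a b c hab hac => h2 _ hab _ hac rfl
  let S : Setoid ℤ :=
    { r := fun i j => ReflTransGen r i j ∨ ReflTransGen r j i
      iseqv := by
        refine ⟨fun i => Or.inl .refl, fun h => h.symm, ?_⟩
        rintro i j k (hij | hij) (hjk | hjk)
        · exact Or.inl (hij.trans hjk)
        · have := ReflTransGen.total_of_right_unique hU' (reflTransGen_swap.2 hij)
            (reflTransGen_swap.2 hjk)
          exact this.symm.imp reflTransGen_swap.1 reflTransGen_swap.1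
        · exact ReflTransGen.total_of_right_unique hU hij hjk
        · exact Or.inr (hjk.trans hij) }
  have hblock : ∀ b ∈ (Finpartition.ofSetSetoid S s).parts, ∀ i ∈ b, ∀ j, j ∈ b ↔
      j ∈ s ∧ (ReflTransGen r i j ∨ ReflTransGen r j i) := by
    intro b hb i hi j
    have := Finpartition.part_eq_of_mem _ hb hi
    rw [← this, Finpartition.mem_part_ofSetSetoid_iff_rel]
    exact ⟨fun h => h.2, fun h => ⟨Finpartition.le _ hb hi, h⟩⟩
  refine ⟨Finpartition.ofSetSetoid S s, ?_⟩
  ext ⟨i, j⟩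
  rw [mem_arcs_iff]
  constructor
  · rintro ⟨hij, b, hb, hi, hj, hm⟩
    rcases ((hblock b hb i hi j).1 hj).2 with h | h
    -- The first step `k` of the chain from `i` to `j` lies in the block, so minimality of `j`
    -- forces `k = j`.
    · rcases ReflTransGen.cases_head h with h | ⟨k, hik, hkj⟩
      · omega
      · have hk : k ∈ b := (hblock b hb i hi k).2 ⟨(h0 _ hik).2.1, Or.inl (.single hik)⟩
        have := hm k hk (hlt _ hik)
        obtain rfl : k = j := le_antisymm (le_of_reflTransGen hlt hkj) this
        exact hik
    · exact absurd (le_of_reflTransGen hlt h) (not_le.2 hij)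
  · intro hij
    obtain ⟨hi, hj, hl⟩ := h0 _ hij
    obtain ⟨b, hb, hib⟩ := (Finpartition.ofSetSetoid S s).exists_mem hi
    refine ⟨hl, b, hb, hib, (hblock b hb i hib j).2 ⟨hj, Or.inl (.single hij)⟩, ?_⟩
    intro k hk hik
    rcases ((hblock b hb i hib k).1 hk).2 with h | h
    · rcases ReflTransGen.cases_head h with h | ⟨l, hil, hlk⟩
      · omega
      · obtain rfl : l = j := h1 _ hil _ hij rfl
        exact le_of_reflTransGen hlt hlk
    · exact absurd (le_of_reflTransGen hlt h) (not_le.2 hik)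

open Classical in
/-- The arc sets of the set partitions of `s`. -/
def arcSets (s : Finset ℤ) : Finset (Finset (ℤ × ℤ)) :=
  (s ×ˢ s).powerset.filter (IsArcSet s)

theorem mem_arcSets {s : Finset ℤ} {A : Finset (ℤ × ℤ)} : A ∈ arcSets s ↔ IsArcSet s A := by
  classical
  rw [arcSets, mem_filter, mem_powerset, and_iff_right_iff_imp]
  exact fun h a ha => mem_product.2 ⟨(h.1 a ha).1, (h.1 a ha).2.1⟩

theorem sum_arcs {s : Finset ℤ} {R : Type*} [AddCommMonoid R] (w : Finset (ℤ × ℤ) → R) :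
    ∑ Λ : Finpartition s, w (arcs Λ) = ∑ A ∈ arcSets s, w A := by
  refine Finset.sum_bij (fun Λ _ => arcs Λ) (fun Λ _ => mem_arcSets.2 (isArcSet_arcs Λ))
    (fun Λ _ Λ' _ h => arcs_injective s h) (fun A hA => ?_) (fun _ _ => rfl)
  obtain ⟨Λ, h⟩ := exists_arcs_eq (mem_arcSets.1 hA)
  exact ⟨Λ, mem_univ _, h⟩

/-- Invariance under `(i, j) ↦ (-j, -i)`, without fixed pairs. -/
def IsMirror (A : Finset (ℤ × ℤ)) : Prop := ∀ a ∈ A, (-a.2, -a.1) ∈ A ∧ a.1 ≠ -a.2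

open Classical in
/-- The arc sets of the signed set partitions of `s`. -/
def mirrorArcSets (s : Finset ℤ) : Finset (Finset (ℤ × ℤ)) := (arcSets s).filter IsMirror

theorem mem_mirrorArcSets {s : Finset ℤ} {A : Finset (ℤ × ℤ)} :
    A ∈ mirrorArcSets s ↔ IsArcSet s A ∧ IsMirror A := by
  classical
  rw [mirrorArcSets, mem_filter, mem_arcSets]

theorem sum_signed {s : Finset ℤ} {R : Type*} [AddCommMonoid R] (w : Finset (ℤ × ℤ) → R) :
    ∑ Λ : Finpartition s with IsSigned Λ, w (arcs Λ) = ∑ A ∈ mirrorArcSets s, w A := by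
  classical
  rw [mirrorArcSets, sum_filter, sum_filter, ← sum_arcs]
  refine Finset.sum_congr rfl fun Λ _ => ?_
  by_cases h : IsSigned Λ
  · rw [if_pos h, if_pos (show IsMirror (arcs Λ) from h)]
  · rw [if_neg h, if_neg (show ¬ IsMirror (arcs Λ) from h)]

/-! ### Growing arc sets by a largest element or an outermost pair. -/

theorem sum_extend {α β R : Type*} [DecidableEq α] [AddCommMonoid R] {S S' : Finset α}
    {T : α → Finset β} {f : α → β → α} (hS : S ⊆ S')
    (hf : ∀ A ∈ S, ∀ i ∈ T A, f A i ∈ S' ∧ f A i ∉ S)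
    (hinj : ∀ A ∈ S, ∀ i ∈ T A, ∀ A' ∈ S, ∀ i' ∈ T A', f A i = f A' i' → A = A' ∧ i = i')
    (hsurj : ∀ B ∈ S', B ∉ S → ∃ A ∈ S, ∃ i ∈ T A, f A i = B) (w : α → R) :
    ∑ B ∈ S', w B = ∑ A ∈ S, (w A + ∑ i ∈ T A, w (f A i)) := by
  rw [sum_add_distrib, ← sum_sdiff hS, add_comm, sum_sigma']
  congr 1
  symm
  refine Finset.sum_bij (fun p _ => f p.1 p.2) ?_ ?_ ?_ fun _ _ => rfl
  · rintro ⟨A, i⟩ h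
    rw [mem_sigma] at h
    exact mem_sdiff.2 (hf A h.1 i h.2)
  · rintro ⟨A, i⟩ h ⟨A', i'⟩ h' he
    rw [mem_sigma] at h h'
    obtain ⟨rfl, rfl⟩ := hinj A h.1 i h.2 A' h'.1 i' h'.2 he
    rfl
  · intro B hB
    rw [mem_sdiff] at hB
    obtain ⟨A, hA, i, hi, he⟩ := hsurj B hB.1 hB.2
    exact ⟨⟨A, i⟩, mem_sigma.2 ⟨hA, hi⟩, he⟩

/-- The elements of `s` that are not the left end of a pair in `A`. -/
def freeRows (s : Finset ℤ) (A : Finset (ℤ × ℤ)) : Finset ℤ :=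
  s.filter fun i => ∀ p ∈ A, p.1 ≠ i

theorem mem_freeRows {s : Finset ℤ} {A : Finset (ℤ × ℤ)} {i : ℤ} :
    i ∈ freeRows s A ↔ i ∈ s ∧ ∀ p ∈ A, p.1 ≠ i := mem_filter

/-- The largest element can only be a right end, and of at most one pair; the partner of `a` is any
element that is not already a left end. -/
theorem sum_arcSets_insert {s : Finset ℤ} {a : ℤ} (ha : ∀ i ∈ s, i < a) {R : Type*}
    [AddCommMonoid R] (w : Finset (ℤ × ℤ) → R) :
    ∑ A ∈ arcSets (insert a s), w A =
      ∑ A ∈ arcSets s, (w A + ∑ i ∈ freeRows s A, w (insert (i, a) A)) := by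
  have hna : ∀ A ∈ arcSets s, ∀ p ∈ A, p.2 ≠ a := fun A hA p hp =>
    (ha _ ((mem_arcSets.1 hA).1 p hp).2.1).ne
  refine sum_extend ?_ ?_ ?_ ?_ w
  · intro A hA
    rw [mem_arcSets] at hA ⊢
    exact ⟨fun p hp => ⟨mem_insert_of_mem (hA.1 p hp).1, mem_insert_of_mem (hA.1 p hp).2.1,
      (hA.1 p hp).2.2⟩, hA.2⟩
  · intro A hA i hi
    have hn := hna A hA
    rw [mem_freeRows] at hi
    refine ⟨?_, fun h => hna _ h (i, a) (mem_insert_self _ _) rfl⟩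
    rw [mem_arcSets] at hA ⊢
    refine ⟨?_, ?_, ?_⟩
    · intro p hp
      rcases mem_insert.1 hp with rfl | hp
      · exact ⟨mem_insert_of_mem hi.1, mem_insert_self _ _, ha _ hi.1⟩
      · exact ⟨mem_insert_of_mem (hA.1 p hp).1, mem_insert_of_mem (hA.1 p hp).2.1,
          (hA.1 p hp).2.2⟩
    · intro p hp q hq hpq
      rcases mem_insert.1 hp with rfl | hp <;> rcases mem_insert.1 hq with rfl | hq
      · rfl
      · exact absurd hpq.symm (hi.2 q hq)
      · exact absurd hpq (hi.2 p hp)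
      · exact hA.2.1 p hp q hq hpq
    · intro p hp q hq hpq
      rcases mem_insert.1 hp with rfl | hp <;> rcases mem_insert.1 hq with rfl | hq
      · rfl
      · exact absurd hpq.symm (hn q hq)
      · exact absurd hpq (hn p hp)
      · exact hA.2.2 p hp q hq hpq
  · intro A hA i _ A' hA' i' _ he
    have hi : (i, a) ∈ insert (i', a) A' := he ▸ mem_insert_self _ _
    obtain rfl : i = i' := by
      rcases mem_insert.1 hi with h | h
      · exact congrArg Prod.fst h
      · exact absurd rfl (hna A' hA' _ h)
    refine ⟨?_, rfl⟩
    rw [← erase_insert (fun h => hna A hA _ h rfl : (i, a) ∉ A), he,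
      erase_insert (fun h => hna A' hA' _ h rfl : (i, a) ∉ A')]
  · intro B hB hBs
    rw [mem_arcSets] at hB hBs
    have hs : ∀ j ∈ insert a s, j < a → j ∈ s := fun j hj hja =>
      (mem_insert.1 hj).resolve_left hja.ne
    have hle : ∀ j ∈ insert a s, j ≤ a := fun j hj => by
      rcases mem_insert.1 hj with rfl | hj
      exacts [le_rfl, (ha j hj).le]
    have hl : ∀ p ∈ B, p.1 ∈ s := fun p hp =>
      hs _ (hB.1 p hp).1 ((hB.1 p hp).2.2.trans_le (hle _ (hB.1 p hp).2.1))
    obtain ⟨i, hi⟩ : ∃ i, (i, a) ∈ B := by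
      by_contra! hcon
      refine hBs ⟨fun p hp => ⟨hl p hp, (mem_insert.1 (hB.1 p hp).2.1).resolve_left ?_,
        (hB.1 p hp).2.2⟩, hB.2⟩
      rintro rfl
      exact hcon p.1 hp
    refine ⟨B.erase (i, a), ?_, i, ?_, insert_erase hi⟩
    · rw [mem_arcSets]
      refine ⟨fun p hp => ?_, fun p hp q hq => hB.2.1 p (mem_of_mem_erase hp) q
        (mem_of_mem_erase hq), fun p hp q hq => hB.2.2 p (mem_of_mem_erase hp) q
        (mem_of_mem_erase hq)⟩
      have hpB := mem_of_mem_erase hp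
      refine ⟨hl p hpB, (mem_insert.1 (hB.1 p hpB).2.1).resolve_left fun h => ?_,
        (hB.1 p hpB).2.2⟩
      exact ne_of_mem_erase hp (Prod.ext (hB.2.2 p hpB _ hi h) h)
    · refine mem_freeRows.2 ⟨hl _ hi, fun p hp h => ?_⟩
      have hpB := mem_of_mem_erase hp
      exact ne_of_mem_erase hp (Prod.ext h (hB.2.1 p hpB _ hi h))

/-- Add the pair `(i, a)` and its mirror image. -/
def addPair (A : Finset (ℤ × ℤ)) (i a : ℤ) : Finset (ℤ × ℤ) := insert (i, a) (insert (-a, -i) A)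

theorem mem_addPair {A : Finset (ℤ × ℤ)} {i a : ℤ} {p : ℤ × ℤ} :
    p ∈ addPair A i a ↔ p = (i, a) ∨ p = (-a, -i) ∨ p ∈ A := by
  rw [addPair, mem_insert, mem_insert]

/-- `s` is symmetric around `0` and lies strictly between `-a` and `a`. -/
structure IsOuter (s : Finset ℤ) (a : ℤ) : Prop where
  pos : 0 < a
  neg_mem : ∀ i ∈ s, -i ∈ s
  lt : ∀ i ∈ s, i < a

theorem IsOuter.neg_lt {s : Finset ℤ} {a : ℤ} (h : IsOuter s a) {i : ℤ} (hi : i ∈ s) : -a < i := by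
  have := h.lt _ (h.neg_mem i hi)
  omega

theorem IsOuter.bounds {s : Finset ℤ} {a : ℤ} (h : IsOuter s a) {A : Finset (ℤ × ℤ)}
    (hA : IsArcSet s A) {p : ℤ × ℤ} (hp : p ∈ A) : -a < p.1 ∧ p.1 < p.2 ∧ p.2 < a :=
  ⟨h.neg_lt (hA.1 p hp).1, (hA.1 p hp).2.2, h.lt _ (hA.1 p hp).2.1⟩

theorem isMirror_snd_ne {s : Finset ℤ} {A : Finset (ℤ × ℤ)} (hA : IsMirror A) {i : ℤ}
    (hi : i ∈ freeRows s A) : ∀ p ∈ A, p.2 ≠ -i := by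
  intro p hp h
  exact (mem_freeRows.1 hi).2 _ (hA p hp).1 (by simp only [h, neg_neg])

/-- By mirror symmetry the pair at `-a` is dictated by the pair at `a`, so a free row `i` is again
the only choice. It lies in `s` because `(-a, a)` is its own mirror image and is forbidden. -/
theorem sum_mirrorArcSets_insert {s : Finset ℤ} {a : ℤ} (ha : IsOuter s a) {R : Type*}
    [AddCommMonoid R] (w : Finset (ℤ × ℤ) → R) :
    ∑ A ∈ mirrorArcSets (insert a (insert (-a) s)), w A =
      ∑ A ∈ mirrorArcSets s, (w A + ∑ i ∈ freeRows s A, w (addPair A i a)) := by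
  have hna : ∀ A ∈ mirrorArcSets s, ∀ p ∈ A, -a < p.1 ∧ p.1 < p.2 ∧ p.2 < a := fun A hA p hp =>
    ha.bounds (mem_mirrorArcSets.1 hA).1 hp
  have hpos := ha.pos
  refine sum_extend ?_ ?_ ?_ ?_ w
  · intro A hA
    rw [mem_mirrorArcSets] at hA ⊢
    exact ⟨⟨fun p hp => ⟨mem_insert_of_mem (mem_insert_of_mem (hA.1.1 p hp).1),
      mem_insert_of_mem (mem_insert_of_mem (hA.1.1 p hp).2.1), (hA.1.1 p hp).2.2⟩, hA.1.2⟩, hA.2⟩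
  · intro A hA i hi
    have hn := hna A hA
    refine ⟨?_, fun h => absurd (hna _ h (i, a) (mem_insert_self _ _)).2.2 (lt_irrefl _)⟩
    rw [mem_mirrorArcSets] at hA ⊢
    have hcol := isMirror_snd_ne hA.2 hi
    rw [mem_freeRows] at hi
    have hi1 := ha.lt _ hi.1
    have hi2 := ha.neg_lt hi.1
    refine ⟨⟨?_, ?_, ?_⟩, ?_⟩
    · intro p hp
      rcases mem_addPair.1 hp with rfl | rfl | hp
      · exact ⟨mem_insert_of_mem (mem_insert_of_mem hi.1), mem_insert_self _ _, hi1⟩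
      · exact ⟨mem_insert_of_mem (mem_insert_self _ _),
          mem_insert_of_mem (mem_insert_of_mem (ha.neg_mem _ hi.1)), by dsimp only; omega⟩
      · exact ⟨mem_insert_of_mem (mem_insert_of_mem (hA.1.1 p hp).1),
          mem_insert_of_mem (mem_insert_of_mem (hA.1.1 p hp).2.1), (hA.1.1 p hp).2.2⟩
    · intro p hp q hq hpq
      rcases mem_addPair.1 hp with rfl | rfl | hp <;>
        rcases mem_addPair.1 hq with rfl | rfl | hq
      · rfl
      · dsimp only at hpq; omega
      · exact absurd hpq.symm (hi.2 q hq)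
      · dsimp only at hpq; omega
      · rfl
      · have := hn q hq; dsimp only at hpq; omega
      · exact absurd hpq (hi.2 p hp)
      · have := hn p hp; dsimp only at hpq; omega
      · exact hA.1.2.1 p hp q hq hpq
    · intro p hp q hq hpq
      rcases mem_addPair.1 hp with rfl | rfl | hp <;>
        rcases mem_addPair.1 hq with rfl | rfl | hq
      · rfl
      · dsimp only at hpq; omega
      · have := hn q hq; dsimp only at hpq; omega
      · dsimp only at hpq; omega
      · rfl
      · exact absurd hpq.symm (hcol q hq)
      · have := hn p hp; dsimp only at hpq; omega
      · exact absurd hpq (hcol p hp)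
      · exact hA.1.2.2 p hp q hq hpq
    · intro p hp
      rcases mem_addPair.1 hp with rfl | rfl | hp
      · exact ⟨mem_addPair.2 (Or.inr (Or.inl rfl)), by dsimp only; omega⟩
      · exact ⟨mem_addPair.2 (Or.inl (by simp only [neg_neg])), by dsimp only; omega⟩
      · exact ⟨mem_addPair.2 (Or.inr (Or.inr (hA.2 p hp).1)), (hA.2 p hp).2⟩
  · intro A hA i hi A' hA' i' hi' he
    -- Deleting the pairs that touch `±a` recovers `A`.
    have key : ∀ A ∈ mirrorArcSets s, ∀ i,
        (addPair A i a).filter (fun p => p.1 ≠ -a ∧ p.2 ≠ a) = A := by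
      intro A hA i
      ext p
      rw [mem_filter, mem_addPair]
      constructor
      · rintro ⟨rfl | rfl | h, h1, h2⟩
        · exact absurd rfl h2
        · exact absurd rfl h1
        · exact h
      · intro h
        have := hna A hA p h
        exact ⟨Or.inr (Or.inr h), this.1.ne', this.2.2.ne⟩
    refine ⟨by rw [← key A hA i, he, key A' hA' i'], ?_⟩
    have hm : (i, a) ∈ addPair A' i' a := he ▸ mem_insert_self _ _
    have := ha.lt _ (mem_freeRows.1 hi').1
    have := ha.neg_lt (mem_freeRows.1 hi').1
    rcases mem_addPair.1 hm with h | h | h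
    · exact congrArg Prod.fst h
    · have := congrArg Prod.snd h
      dsimp only at this
      omega
    · exact absurd (hna A' hA' _ h).2.2 (lt_irrefl _)
  · intro B hB hBs
    rw [mem_mirrorArcSets] at hB hBs
    obtain ⟨hB, hBm⟩ := hB
    have hs : ∀ j ∈ insert a (insert (-a) s), j ≠ a → j ≠ -a → j ∈ s := fun j hj h h' =>
      (mem_insert.1 ((mem_insert.1 hj).resolve_left h)).resolve_left h'
    have hle : ∀ j ∈ insert a (insert (-a) s), -a ≤ j ∧ j ≤ a := fun j hj => by
      rcases mem_insert.1 hj with rfl | hj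
      · omega
      · rcases mem_insert.1 hj with rfl | hj
        · omega
        · exact ⟨(ha.neg_lt hj).le, (ha.lt _ hj).le⟩
    have hlt : ∀ p ∈ B, -a ≤ p.1 ∧ p.1 < p.2 ∧ p.2 ≤ a := fun p hp =>
      ⟨(hle _ (hB.1 p hp).1).1, (hB.1 p hp).2.2, (hle _ (hB.1 p hp).2.1).2⟩
    obtain ⟨i, hi⟩ : ∃ i, (i, a) ∈ B := by
      by_contra! hcon
      -- A pair starting at `-a` would have a mirror image ending at `a`.
      have hcon' : ∀ j, (-a, j) ∉ B := fun j hj => hcon _ (by simpa using (hBm _ hj).1)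
      refine hBs ⟨⟨fun p hp => ?_, hB.2⟩, hBm⟩
      have h1 : p.2 ≠ a := fun h => hcon p.1 (h ▸ hp)
      have h2 : p.1 ≠ -a := fun h => hcon' p.2 (h ▸ hp)
      have := hlt p hp
      exact ⟨hs _ (hB.1 p hp).1 (by omega) h2, hs _ (hB.1 p hp).2.1 h1 (by omega), this.2.1⟩
    have hi' : (-a, -i) ∈ B := (hBm _ hi).1
    have hia : i ≠ -a := (hBm _ hi).2
    have his : i ∈ s := hs _ (hB.1 _ hi).1 (hlt _ hi).2.1.ne hia
    have hmem : ∀ p, p ∈ B.filter (fun p => p.1 ≠ -a ∧ p.2 ≠ a) ↔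
        p ∈ B ∧ p.1 ≠ -a ∧ p.2 ≠ a := fun p => mem_filter
    refine ⟨B.filter (fun p => p.1 ≠ -a ∧ p.2 ≠ a), ?_, i, ?_, ?_⟩
    · rw [mem_mirrorArcSets]
      refine ⟨⟨fun p hp => ?_, fun p hp q hq => hB.2.1 p (mem_filter.1 hp).1 q (mem_filter.1 hq).1,
        fun p hp q hq => hB.2.2 p (mem_filter.1 hp).1 q (mem_filter.1 hq).1⟩, fun p hp => ?_⟩
      · obtain ⟨hp, h1, h2⟩ := (hmem p).1 hp
        have := hlt p hp
        exact ⟨hs _ (hB.1 p hp).1 (by omega) h1, hs _ (hB.1 p hp).2.1 h2 (by omega), this.2.1⟩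
      · obtain ⟨hp, h1, h2⟩ := (hmem p).1 hp
        refine ⟨(hmem _).2 ⟨(hBm p hp).1, ?_, ?_⟩, (hBm p hp).2⟩
        · dsimp only; omega
        · dsimp only; omega
    · refine mem_freeRows.2 ⟨his, fun p hp h => ?_⟩
      obtain ⟨hp, h1, h2⟩ := (hmem p).1 hp
      exact h2 (hB.2.1 p hp _ hi h)
    · ext p
      rw [mem_addPair, hmem]
      constructor
      · rintro (rfl | rfl | h)
        exacts [hi, hi', h.1]
      · intro hp
        by_cases h2 : p.2 = a
        · exact Or.inl (Prod.ext (hB.2.2 p hp _ hi h2) h2)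
        · by_cases h1 : p.1 = -a
          · exact Or.inr (Or.inl (Prod.ext h1 (hB.2.1 p hp _ hi' h1)))
          · exact Or.inr (Or.inr ⟨hp, h1, h2⟩)

theorem groundA_succ (n : ℕ) : groundA (n + 1) = insert ((n : ℤ) + 1) (groundA n) := by
  ext i
  simp only [groundA, mem_insert, mem_Icc, Nat.cast_add, Nat.cast_one]
  omega

theorem groundB_succ (n : ℕ) :
    groundB (n + 1) = insert ((n : ℤ) + 1) (insert (-((n : ℤ) + 1)) (groundB n)) := by
  ext i
  simp only [groundB, mem_insert, mem_Icc, Nat.cast_add, Nat.cast_one]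
  omega

theorem groundD_succ (n : ℕ) :
    groundD (n + 1) = insert ((n : ℤ) + 1) (insert (-((n : ℤ) + 1)) (groundD n)) := by
  ext i
  simp only [groundD, groundB, mem_erase, mem_insert, mem_Icc, Nat.cast_add, Nat.cast_one]
  omega

theorem lt_of_mem_groundA {n : ℕ} {i : ℤ} (hi : i ∈ groundA n) : i < (n : ℤ) + 1 := by
  rw [groundA, mem_Icc] at hi
  omega

theorem isOuter_groundB (n : ℕ) : IsOuter (groundB n) ((n : ℤ) + 1) := by
  refine ⟨by omega, fun i hi => ?_, fun i hi => ?_⟩ <;> simp only [groundB, mem_Icc] at hi ⊢ <;>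
    omega

theorem isOuter_groundD (n : ℕ) : IsOuter (groundD n) ((n : ℤ) + 1) := by
  refine ⟨by omega, fun i hi => ?_, fun i hi => ?_⟩ <;>
    simp only [groundD, groundB, mem_erase, mem_Icc] at hi ⊢ <;> omega

/-! ### Transfer operators and the binomial transform. -/

section operators

variable {R M N : Type*} [CommRing R] [AddCommGroup M] [Module R M] [AddCommGroup N] [Module R N]

theorem pow_add_smul_apply (P : Module.End R M) (c : R) (n : ℕ) (g : M) :
    ((P + c • 1) ^ n) g =
      ∑ k ∈ range (n + 1), ((n.choose k : R) * c ^ (n - k)) • (P ^ k) g := by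
  have h : Commute P (c • (1 : Module.End R M)) := (Commute.one_right P).smul_right c
  rw [h.add_pow, LinearMap.sum_apply]
  refine sum_congr rfl fun k _ => ?_
  rw [smul_pow, one_pow, ← nsmul_eq_mul', LinearMap.smul_apply, mul_smul_comm, mul_one,
    LinearMap.smul_apply, ← Nat.cast_smul_eq_nsmul R, smul_smul]

/-- Scalars pass through a linear map, so an intertwining relation survives the same scalar shift on
both sides. This lets the parameter `y` ride along in every comparison of operators. -/
theorem pow_add_smul_intertwine {P : Module.End R M} {Q : Module.End R N} {ψ : N → M}
    (hadd : ∀ g h, ψ (g + h) = ψ g + ψ h) (hsmul : ∀ (c : R) g, ψ (c • g) = c • ψ g)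
    (h : ∀ g, P (ψ g) = ψ (Q g)) (c : R) (n : ℕ) :
    ∀ g, ((P + c • 1) ^ n) (ψ g) = ψ (((Q + c • 1) ^ n) g) := by
  induction n with
  | zero => intro g; simp
  | succ n ih =>
    intro g
    have : (P + c • 1) (ψ g) = ψ ((Q + c • 1) g) := by
      simp only [LinearMap.add_apply, LinearMap.smul_apply, Module.End.one_apply, hadd, hsmul, h]
    rw [pow_succ, Module.End.mul_apply, this, ih, pow_succ, Module.End.mul_apply]

/-- The effect of adding an outermost pair of elements to a signed set partition, on functions of
the number of blocks. -/
def countOp (x : R) : Module.End R (ℕ → R) where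
  toFun g w := g (w + 2) + x * w * g w
  map_add' g h := by ext w; simp only [Pi.add_apply]; ring
  map_smul' c g := by ext w; simp only [Pi.smul_apply, smul_eq_mul, RingHom.id_apply]; ring

theorem countOp_apply (x : R) (g : ℕ → R) (w : ℕ) :
    countOp x g w = g (w + 2) + x * w * g w := rfl

/-- The refinement of `countOp` keeping track of the pairs of singleton blocks. -/
def bellOp (x : R) : Module.End R (ℕ → ℕ → R) where
  toFun g s r := g (s + 1) r + 2 * x * s * g (s - 1) (r + 2) + x * r * g s r
  map_add' g h := by ext s r; simp only [Pi.add_apply]; ring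
  map_smul' c g := by ext s r; simp only [Pi.smul_apply, smul_eq_mul, RingHom.id_apply]; ring

theorem bellOp_apply (x : R) (g : ℕ → ℕ → R) (s r : ℕ) :
    bellOp x g s r = g (s + 1) r + 2 * x * s * g (s - 1) (r + 2) + x * r * g s r := rfl

/-- Both attaching moves of `bellOp` preserve the total `2 * s + r`, and their weights `2 * x * s`
and `x * r` add up to `x` times that total. -/
theorem bellOp_comp_count (x : R) (g : ℕ → R) :
    bellOp x (fun s r => g (2 * s + r)) = fun s r => countOp x g (2 * s + r) := by
  ext s r
  rw [bellOp_apply, countOp_apply]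
  -- At `s = 0` the truncated `s - 1` is harmless because its coefficient vanishes.
  rcases s with _ | s
  · simp only [Nat.cast_zero, mul_zero, zero_mul, add_zero, zero_add]
    rw [add_comm 2 r]
  · rw [Nat.add_sub_cancel, show 2 * (s + 1 + 1) + r = 2 * (s + 1) + r + 2 by ring,
      show 2 * s + (r + 2) = 2 * (s + 1) + r by ring]
    push_cast
    ring

/-- Sum over the subsets of a set of size `v`. -/
def binomTransform (g : ℕ → R) (v : ℕ) : R := ∑ h ∈ range (v + 1), (v.choose h : R) * g h

theorem binomTransform_add (g h : ℕ → R) :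
    binomTransform (g + h) = binomTransform g + binomTransform h := by
  ext v
  simp only [binomTransform, Pi.add_apply, mul_add, sum_add_distrib]

theorem binomTransform_smul (c : R) (g : ℕ → R) :
    binomTransform (c • g) = c • binomTransform g := by
  ext v
  simp only [binomTransform, Pi.smul_apply, smul_eq_mul, mul_sum]
  exact sum_congr rfl fun _ _ => by ring

theorem binomTransform_succ (g : ℕ → R) (v : ℕ) :
    binomTransform g (v + 1) = binomTransform g v + binomTransform (fun h => g (h + 1)) v := by
  simp only [binomTransform]
  rw [sum_range_succ' _ (v + 1)]
  simp only [Nat.choose_succ_succ, Nat.cast_add, add_mul, sum_add_distrib]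
  rw [sum_range_succ' (fun h => (v.choose h : R) * g h) v, sum_range_succ _ v]
  simp only [Nat.succ_eq_add_one, sum_range_succ, Nat.choose_succ_self, Nat.choose_zero_right,
    Nat.cast_zero, Nat.cast_one, zero_mul, add_zero]
  ring

/-- Choosing a point and then a subset of the rest is the same as choosing a nonempty subset with a
marked point. -/
theorem mul_binomTransform_pred (g : ℕ → R) (v : ℕ) :
    (v : R) * binomTransform g (v - 1) = binomTransform (fun h => h * g (h - 1)) v := by
  rcases v with _ | v
  · simp [binomTransform]
  · simp only [binomTransform, Nat.add_sub_cancel]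
    rw [sum_range_succ' _ (v + 1), mul_sum]
    simp only [Nat.cast_zero, zero_mul, mul_zero, add_zero, Nat.add_sub_cancel]
    refine sum_congr rfl fun h _ => ?_
    have := congrArg (Nat.cast (R := R)) (Nat.add_one_mul_choose_eq v h)
    push_cast at this ⊢
    linear_combination g h * this

/-- The hockey-stick identity, applied termwise. -/
theorem sum_range_binomTransform (g : ℕ → R) (v : ℕ) :
    ∑ u ∈ range v, binomTransform g u =
      binomTransform (fun h => if h = 0 then 0 else g (h - 1)) v := by
  induction v with
  | zero => simp [binomTransform]
  | succ v ih =>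
    rw [sum_range_succ, ih, binomTransform_succ]
    simp

theorem binomTransform_delta (c : R) (v : ℕ) :
    binomTransform (fun h => if h = 0 then c else 0) v = c := by
  simp [binomTransform]

theorem binomTransform_zero (g : ℕ → R) : binomTransform g 0 = g 0 := by
  simp [binomTransform]

/-- `binomTransform` in the first variable. -/
def binomTransform₂ (g : ℕ → ℕ → R) (s r : ℕ) : R := binomTransform (fun h => g h r) s

/-- The transform sums over which of the `s` pairs are selected. A newly created pair is either
selected, as in `bellOp`, or not selected, which changes nothing: this is the extra identity
operator. -/
theorem bellOp_binomTransform (x : R) (g : ℕ → ℕ → R) :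
    bellOp x (binomTransform₂ g) = binomTransform₂ ((bellOp x + (1 : R) • 1) g) := by
  ext s r
  have h1 := binomTransform_succ (fun h => g h r) s
  have h2 := mul_binomTransform_pred (fun h => g h (r + 2)) s
  have h3 : binomTransform₂ ((bellOp x + (1 : R) • 1) g) s r =
      binomTransform (fun h => g h r) s + binomTransform (fun h => g (h + 1) r) s
        + 2 * x * binomTransform (fun h => h * g (h - 1) (r + 2)) s
        + x * r * binomTransform (fun h => g h r) s := by
    simp only [binomTransform₂, binomTransform, mul_sum, ← sum_add_distrib]
    refine sum_congr rfl fun h _ => ?_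
    simp only [LinearMap.add_apply, Module.End.one_apply, Pi.add_apply,
      bellOp_apply, one_smul]
    ring
  rw [bellOp_apply, h3, ← h1, ← h2]
  simp only [binomTransform₂]
  ring

/-- The indicator function of `0` in the first variable. -/
def deltaLeft : ℕ → ℕ → R := fun s _ => if s = 0 then 1 else 0

theorem binomTransform₂_deltaLeft : binomTransform₂ (deltaLeft (R := R)) = fun _ _ => 1 := by
  ext s r
  exact binomTransform_delta 1 s

theorem countOp_pow_eq_sum (x y : R) (n r : ℕ) :
    ((countOp x + y • 1) ^ n) (fun _ => 1) r =
      ∑ k ∈ range (n + 1), (n.choose k : R) * ((bellOp x ^ k) fun _ _ => 1) 0 r * y ^ (n - k) := by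
  have h := pow_add_smul_intertwine (P := bellOp x) (Q := countOp x)
    (ψ := fun g s r => g (2 * s + r)) (fun _ _ => rfl) (fun _ _ => rfl) (bellOp_comp_count x) y n
    (fun _ => 1)
  have h' := congrFun (congrFun h 0) r
  simp only [mul_zero, zero_add] at h'
  rw [← h', pow_add_smul_apply]
  simp only [Finset.sum_apply, Pi.smul_apply, smul_eq_mul]
  exact sum_congr rfl fun k _ => by ring

theorem bellOp_pow_one_eq_sum (x y : R) (n r : ℕ) :
    ((bellOp x + y • 1) ^ n) (fun _ _ => 1) 0 r =
      ∑ k ∈ range (n + 1), (n.choose k : R) * ((bellOp x ^ k) deltaLeft) 0 r *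
        (y + 1) ^ (n - k) := by
  have h := pow_add_smul_intertwine (P := bellOp x) (Q := bellOp x + (1 : R) • 1)
    (ψ := binomTransform₂) (fun g h => by ext s r; exact congrFun (binomTransform_add _ _) s)
    (fun c g => by ext s r; exact congrFun (binomTransform_smul _ _) s)
    (bellOp_binomTransform x) y n deltaLeft
  rw [binomTransform₂_deltaLeft] at h
  rw [h, binomTransform₂, binomTransform_zero, add_assoc, ← add_smul, pow_add_smul_apply]
  simp only [Finset.sum_apply, Pi.smul_apply, smul_eq_mul]
  exact sum_congr rfl fun k _ => by ring

/-- Since the constant function depends only on the total, `countOp` may be replaced by `bellOp`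
started at `(0, r)`; then the transform applies. -/
theorem countOp_pow_eq_sum_delta (x y : R) (n r : ℕ) :
    ((countOp x + y • 1) ^ n) (fun _ => 1) r =
      ∑ k ∈ range (n + 1), (n.choose k : R) * ((bellOp x ^ k) deltaLeft) 0 r *
        (y + 1) ^ (n - k) := by
  rw [← bellOp_pow_one_eq_sum, countOp_pow_eq_sum, pow_add_smul_apply]
  simp only [Finset.sum_apply, Pi.smul_apply, smul_eq_mul]
  exact sum_congr rfl fun k _ => by ring

end operators

variable {R : Type*} [CommRing R]

/-! ### Set partitions of `[n]`: isolated points and tips. -/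

theorem freeRows_insert_of_mem {s : Finset ℤ} {A : Finset (ℤ × ℤ)} {i a : ℤ}
    (ha : ∀ i ∈ s, i < a) (hA : IsArcSet s A) (hi : i ∈ s) :
    freeRows (insert a s) (insert (i, a) A) = insert a ((freeRows s A).erase i) := by
  ext j
  simp only [mem_freeRows, mem_insert, mem_erase, forall_eq_or_imp]
  constructor
  · rintro ⟨rfl | hj, hij, h⟩
    · exact Or.inl rfl
    · exact Or.inr ⟨Ne.symm hij, hj, h⟩
  · rintro (rfl | ⟨hij, hj, h⟩)
    · exact ⟨Or.inl rfl, (ha i hi).ne, fun p hp => (ha _ (hA.1 p hp).1).ne⟩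
    · exact ⟨Or.inr hj, Ne.symm hij, h⟩

theorem freeRows_insert {s : Finset ℤ} {A : Finset (ℤ × ℤ)} {a : ℤ}
    (ha : ∀ i ∈ s, i < a) (hA : IsArcSet s A) :
    freeRows (insert a s) A = insert a (freeRows s A) := by
  ext j
  simp only [mem_freeRows, mem_insert]
  constructor
  · rintro ⟨rfl | hj, h⟩
    · exact Or.inl rfl
    · exact Or.inr ⟨hj, h⟩
  · rintro (rfl | ⟨hj, h⟩)
    · exact ⟨Or.inl rfl, fun p hp => (ha _ (hA.1 p hp).1).ne⟩
    · exact ⟨Or.inr hj, h⟩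

/-- The elements of `s` in no pair of `A`. -/
def isolated (s : Finset ℤ) (A : Finset (ℤ × ℤ)) : Finset ℤ :=
  (freeRows s A).filter fun i => ∀ p ∈ A, p.2 ≠ i

/-- The elements of `s` that are the right end of a pair of `A` but not the left end of one. -/
def tips (s : Finset ℤ) (A : Finset (ℤ × ℤ)) : Finset ℤ :=
  (freeRows s A).filter fun i => ¬ ∀ p ∈ A, p.2 ≠ i

theorem card_isolated_insert {s : Finset ℤ} {A : Finset (ℤ × ℤ)} {a : ℤ}
    (ha : ∀ i ∈ s, i < a) (hA : IsArcSet s A) :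
    (isolated (insert a s) A).card = (isolated s A).card + 1 ∧
      (tips (insert a s) A).card = (tips s A).card := by
  have h : ∀ p ∈ A, p.2 ≠ a := fun p hp => (ha _ (hA.1 p hp).2.1).ne
  have hna : a ∉ s := fun h => lt_irrefl _ (ha a h)
  rw [isolated, tips, freeRows_insert ha hA, filter_insert, filter_insert, if_pos h,
    if_neg (not_not.2 h)]
  refine ⟨card_insert_of_notMem fun h => hna ?_, rfl⟩
  exact (mem_freeRows.1 (mem_filter.1 h).1).1

/-- The row `i` ceases to be free and `a` becomes a tip in its place: an isolated point is thus
traded for a tip, and a tip for another tip. -/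
theorem card_isolated_insert_pair {s : Finset ℤ} {A : Finset (ℤ × ℤ)} {i a : ℤ}
    (ha : ∀ i ∈ s, i < a) (hA : IsArcSet s A) (hi : i ∈ freeRows s A) :
    (i ∈ isolated s A → (isolated (insert a s) (insert (i, a) A)).card = (isolated s A).card - 1 ∧
      (tips (insert a s) (insert (i, a) A)).card = (tips s A).card + 1) ∧
    (i ∈ tips s A → (isolated (insert a s) (insert (i, a) A)).card = (isolated s A).card ∧
      (tips (insert a s) (insert (i, a) A)).card = (tips s A).card) := by
  have his := (mem_freeRows.1 hi).1
  have hna : a ∉ s := fun h => lt_irrefl _ (ha a h)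
  have hnt : a ∉ (tips s A).erase i := fun h =>
    hna (mem_freeRows.1 (mem_filter.1 (mem_of_mem_erase h)).1).1
  have h1 : isolated (insert a s) (insert (i, a) A) = (isolated s A).erase i := by
    ext j
    rw [isolated, freeRows_insert_of_mem ha hA his]
    simp only [isolated, mem_filter, mem_insert, mem_erase, forall_eq_or_imp]
    constructor
    · rintro ⟨rfl | hj, h, h'⟩
      · exact absurd rfl h
      · exact ⟨hj.1, hj.2, h'⟩
    · rintro ⟨hji, hj, h'⟩
      exact ⟨Or.inr ⟨hji, hj⟩, fun h => hna (h ▸ (mem_freeRows.1 hj).1), h'⟩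
  have h2 : tips (insert a s) (insert (i, a) A) = insert a ((tips s A).erase i) := by
    ext j
    rw [tips, freeRows_insert_of_mem ha hA his]
    simp only [tips, mem_filter, mem_insert, mem_erase, forall_eq_or_imp]
    constructor
    · rintro ⟨rfl | hj, h⟩
      · exact Or.inl rfl
      · refine Or.inr ⟨hj.1, hj.2, fun h' => h ⟨fun h'' => hna (h'' ▸ (mem_freeRows.1 hj.2).1), h'⟩⟩
    · rintro (rfl | ⟨hji, hj, h'⟩)
      · exact ⟨Or.inl rfl, fun h => h.1 rfl⟩
      · exact ⟨Or.inr ⟨hji, hj⟩, fun h => h' h.2⟩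
  rw [h1, h2, card_insert_of_notMem hnt]
  refine ⟨fun h => ?_, fun h => ?_⟩
  · have hn : i ∉ tips s A := fun h' => (mem_filter.1 h').2 (mem_filter.1 h).2
    rw [card_erase_of_mem h, erase_eq_of_notMem hn]
    exact ⟨rfl, rfl⟩
  · have hn : i ∉ isolated s A := fun h' => (mem_filter.1 h).2 (mem_filter.1 h').2
    rw [erase_eq_of_notMem hn, card_erase_add_one h]
    exact ⟨rfl, rfl⟩

theorem sum_freeRows (s : Finset ℤ) (A : Finset (ℤ × ℤ)) (f : ℤ → R) :
    ∑ i ∈ freeRows s A, f i = ∑ i ∈ isolated s A, f i + ∑ i ∈ tips s A, f i :=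
  (sum_filter_add_sum_filter_not _ _ _).symm

/-- The weight `2 * x` per arc and the doubled number of tips are chosen so that the recurrence
becomes that of `bellOp`: attaching to a tip contributes `2 * x * tips = x * r`, and a new tip
raises `r` by `2`. -/
theorem sum_arcSets_groundA (x : R) (n : ℕ) : ∀ f : ℕ → ℕ → R,
    ∑ A ∈ arcSets (groundA n),
        (2 * x) ^ A.card * f (isolated (groundA n) A).card (2 * (tips (groundA n) A).card) =
      (bellOp x ^ n) f 0 0 := by
  induction n with
  | zero =>
    intro f
    have h : arcSets (groundA 0) = {∅} := by
      ext A
      simp only [mem_arcSets, mem_singleton]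
      constructor
      · intro hA
        exact eq_empty_of_forall_notMem fun p hp => by simpa [groundA] using (hA.1 p hp).1
      · rintro rfl
        simp [IsArcSet]
    rw [h]
    simp [groundA, isolated, tips, freeRows]
  | succ n ih =>
    intro f
    rw [groundA_succ, sum_arcSets_insert fun i => lt_of_mem_groundA, pow_succ,
      Module.End.mul_apply, ← ih]
    refine sum_congr rfl fun A hA => ?_
    rw [mem_arcSets] at hA
    have ha : ∀ i ∈ groundA n, i < (n : ℤ) + 1 := fun i => lt_of_mem_groundA
    obtain ⟨h1, h2⟩ := card_isolated_insert ha hA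
    have hcard : ∀ i, (insert (i, (n : ℤ) + 1) A).card = A.card + 1 := fun i =>
      card_insert_of_notMem fun h => absurd (hA.1 _ h).2.1 fun h => lt_irrefl _ (ha _ h)
    rw [sum_freeRows, h1, h2, bellOp_apply]
    have e1 : ∀ i ∈ isolated (groundA n) A,
        (2 * x) ^ (insert (i, (n : ℤ) + 1) A).card *
          f (isolated (insert ((n : ℤ) + 1) (groundA n)) (insert (i, (n : ℤ) + 1) A)).card
            (2 * (tips (insert ((n : ℤ) + 1) (groundA n)) (insert (i, (n : ℤ) + 1) A)).card) =
        (2 * x) ^ (A.card + 1) * f ((isolated (groundA n) A).card - 1)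
          (2 * (tips (groundA n) A).card + 2) := by
      intro i hi
      obtain ⟨h1, h2⟩ := (card_isolated_insert_pair ha hA (mem_filter.1 hi).1).1 hi
      rw [h1, h2, hcard, mul_add, mul_one]
    have e2 : ∀ i ∈ tips (groundA n) A,
        (2 * x) ^ (insert (i, (n : ℤ) + 1) A).card *
          f (isolated (insert ((n : ℤ) + 1) (groundA n)) (insert (i, (n : ℤ) + 1) A)).card
            (2 * (tips (insert ((n : ℤ) + 1) (groundA n)) (insert (i, (n : ℤ) + 1) A)).card) =
        (2 * x) ^ (A.card + 1) * f (isolated (groundA n) A).card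
          (2 * (tips (groundA n) A).card) := by
      intro i hi
      obtain ⟨h1, h2⟩ := (card_isolated_insert_pair ha hA (mem_filter.1 hi).1).2 hi
      rw [h1, h2, hcard]
    rw [sum_congr rfl e1, sum_congr rfl e2, sum_const, sum_const, nsmul_eq_mul, nsmul_eq_mul]
    push_cast
    ring

theorem bell_eq (x : R) (n : ℕ) : bell n (2 * x) = (bellOp x ^ n) (fun _ _ => 1) 0 0 := by
  rw [← sum_arcSets_groundA, bell, sum_arcs (fun A => (2 * x) ^ A.card)]
  simp only [mul_one]

theorem isFeasible_iff {s : Finset ℤ} (Λ : Finpartition s) :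
    IsFeasible Λ ↔ (isolated s (arcs Λ)).card = 0 := by
  rw [card_eq_zero]
  constructor
  · intro h
    refine eq_empty_of_forall_notMem fun i hi => ?_
    simp only [isolated, mem_filter, mem_freeRows] at hi
    obtain ⟨⟨his, h1⟩, h2⟩ := hi
    obtain ⟨b, hb, hib⟩ := Λ.exists_mem his
    obtain ⟨j, hj, hji⟩ := exists_mem_ne (h b hb) i
    rcases lt_or_gt_of_ne hji with hij | hij
    · obtain ⟨k, -, hk, -⟩ := exists_arc_left hb hj hib hij
      exact h2 _ hk rfl
    · obtain ⟨k, -, hk, -⟩ := exists_arc_right hb hib hj hij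
      exact h1 _ hk rfl
  · intro h b hb
    by_contra hlt
    obtain ⟨i, hi⟩ := Λ.nonempty_of_mem_parts hb
    have hb1 : ∀ j ∈ b, j = i := fun j hj => card_le_one.1 (by omega) j hj i hi
    have : i ∈ isolated s (arcs Λ) := by
      simp only [isolated, mem_filter, mem_freeRows]
      refine ⟨⟨Λ.le hb hi, ?_⟩, ?_⟩
      · rintro ⟨p, q⟩ hp (rfl : p = i)
        have := (mem_arcs_iff.1 hp).1
        rw [hb1 q (mem_of_arc_left hb hp hi)] at this
        exact lt_irrefl _ this
      · rintro ⟨p, q⟩ hp (rfl : q = i)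
        have := (mem_arcs_iff.1 hp).1
        rw [hb1 p (mem_of_arc_right hb hp hi)] at this
        exact lt_irrefl _ this
    rw [h] at this
    exact absurd this (notMem_empty i)

theorem feasible_eq (x : R) (n : ℕ) : feasible n (2 * x) = (bellOp x ^ n) deltaLeft 0 0 := by
  rw [← sum_arcSets_groundA, ← sum_arcs (fun A => (2 * x) ^ A.card *
    deltaLeft (isolated (groundA n) A).card (2 * (tips (groundA n) A).card)), feasible, sum_filter]
  refine sum_congr rfl fun Λ _ => ?_
  rw [deltaLeft, mul_ite, mul_one, mul_zero]
  exact if_congr (isFeasible_iff Λ) rfl rfl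

/-! ### Signed partitions: the number of free rows, with covers. -/

/-- A sequence of symmetric sets, each obtained from the previous one by adding an outermost pair
of opposite elements. -/
structure IsTower (G : ℕ → Finset ℤ) (b : ℕ) : Prop where
  outer : ∀ n : ℕ, IsOuter (G n) ((n : ℤ) + b + 1)
  succ : ∀ n : ℕ,
    G (n + 1) = insert ((n : ℤ) + b + 1) (insert (-((n : ℤ) + b + 1)) (G n))
  base : mirrorArcSets (G 0) = {∅}
  max_mem : ∀ n : ℕ, (n : ℤ) + b ∈ G n

theorem isTower_groundB : IsTower groundB 0 := by
  refine ⟨fun n => by simpa using isOuter_groundB n, fun n => by simpa using groundB_succ n, ?_,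
    fun n => ?_⟩
  · ext A
    simp only [mem_mirrorArcSets, mem_singleton]
    constructor
    · rintro ⟨hA, -⟩
      refine eq_empty_of_forall_notMem fun p hp => ?_
      have := hA.1 p hp
      simp only [groundB, mem_Icc] at this
      omega
    · rintro rfl
      simp [IsArcSet, IsMirror]
  · simp only [groundB, mem_Icc]
    omega

/-- The tower starts at `{-1, 1}`, whose only increasing pair is its own mirror image and hence
forbidden. This is the source of the index `n + 1` in type D. -/
theorem isTower_groundD : IsTower (fun n => groundD (n + 1)) 1 := by
  refine ⟨fun n => by simpa using isOuter_groundD (n + 1),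
    fun n => by simpa using groundD_succ (n + 1), ?_, fun n => ?_⟩
  · ext A
    simp only [mem_mirrorArcSets, mem_singleton]
    constructor
    · rintro ⟨hA, hA'⟩
      refine eq_empty_of_forall_notMem fun p hp => ?_
      have := hA.1 p hp
      have := (hA' p hp).2
      simp only [groundD, groundB, mem_erase, mem_Icc] at *
      omega
    · rintro rfl
      simp [IsArcSet, IsMirror]
  · simp only [groundD, groundB, mem_erase, mem_Icc]
    omega

/-- The pairs of the form `(i, i + 1)`. -/
def covPairs (A : Finset (ℤ × ℤ)) : Finset (ℤ × ℤ) := A.filter fun a => a.2 = a.1 + 1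

/-- The weight `x ^ (|A \ Cov| / 2) * y ^ (|Cov| / 2)` of an arc set. -/
def arcWeight (A : Finset (ℤ × ℤ)) (x y : R) : R :=
  x ^ ((A \ covPairs A).card / 2) * y ^ ((covPairs A).card / 2)

theorem weight_eq_arcWeight {s : Finset ℤ} (Λ : Finpartition s) (x y : R) :
    weight Λ x y = arcWeight (arcs Λ) x y := rfl

theorem card_addPair {A : Finset (ℤ × ℤ)} {i a : ℤ} (h : ∀ p ∈ A, -a < p.1 ∧ p.1 < p.2 ∧ p.2 < a)
    (hi : -a < i) : (addPair A i a).card = A.card + 2 := by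
  have h1 : (-a, -i) ∉ A := fun hp => absurd (h _ hp).1 (lt_irrefl _)
  have h2 : (i, a) ∉ insert (-a, -i) A := by
    intro hp
    rcases mem_insert.1 hp with hp | hp
    · have h1 := congrArg Prod.fst hp
      have h2 := congrArg Prod.snd hp
      dsimp only at h1 h2
      omega
    · exact absurd (h _ hp).2.2 (lt_irrefl _)
  rw [addPair, card_insert_of_notMem h2, card_insert_of_notMem h1]

/-- The pair `(i, a)` and its mirror image are both covers or both not, so exactly one of the halved
exponents grows, by one. No parity of the old cardinalities is needed. -/
theorem arcWeight_addPair {A : Finset (ℤ × ℤ)} {i a : ℤ}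
    (h : ∀ p ∈ A, -a < p.1 ∧ p.1 < p.2 ∧ p.2 < a) (hi : -a < i) (x y : R) :
    arcWeight (addPair A i a) x y = (if i + 1 = a then y else x) * arcWeight A x y := by
  have hsub : covPairs A ⊆ A := filter_subset _ _
  have hsub' : covPairs (addPair A i a) ⊆ addPair A i a := filter_subset _ _
  have hle := card_le_card hsub
  simp only [arcWeight, card_sdiff_of_subset hsub, card_sdiff_of_subset hsub', card_addPair h hi]
  by_cases hia : i + 1 = a
  · have hc : covPairs (addPair A i a) = addPair (covPairs A) i a := by
      rw [covPairs, addPair, filter_insert, filter_insert, if_pos (by dsimp only; omega),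
        if_pos (by dsimp only; omega)]
      rfl
    rw [hc, card_addPair (fun p hp => h p (hsub hp)) hi, if_pos hia,
      Nat.add_sub_add_right, Nat.add_div_right _ two_pos, pow_succ]
    ring
  · have hc : covPairs (addPair A i a) = covPairs A := by
      rw [covPairs, addPair, filter_insert, filter_insert, if_neg (by dsimp only; omega),
        if_neg (by dsimp only; omega)]
      rfl
    rw [hc, if_neg hia, Nat.sub_add_comm hle, Nat.add_div_right _ two_pos, pow_succ]
    ring

theorem freeRows_addPair {s : Finset ℤ} {A : Finset (ℤ × ℤ)} {i a : ℤ}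
    (ha : IsOuter s a) (hA : IsArcSet s A) (hi : i ∈ s) :
    freeRows (insert a (insert (-a) s)) (addPair A i a) = insert a ((freeRows s A).erase i) := by
  have := ha.lt i hi
  have := ha.neg_lt hi
  ext j
  simp only [mem_freeRows, mem_insert, mem_erase, addPair, forall_eq_or_imp]
  constructor
  · rintro ⟨rfl | rfl | hj, hij, hj', h⟩
    · exact Or.inl rfl
    · exact absurd rfl hj'
    · exact Or.inr ⟨Ne.symm hij, hj, h⟩
  · rintro (rfl | ⟨hij, hj, h⟩)
    · exact ⟨Or.inl rfl, by omega, by omega, fun p hp => (ha.lt _ (hA.1 p hp).1).ne⟩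
    · exact ⟨Or.inr (Or.inr hj), Ne.symm hij, (ha.neg_lt hj).ne, h⟩

theorem freeRows_insert_neg {s : Finset ℤ} {A : Finset (ℤ × ℤ)} {a : ℤ}
    (ha : IsOuter s a) (hA : IsArcSet s A) :
    freeRows (insert a (insert (-a) s)) A = insert a (insert (-a) (freeRows s A)) := by
  ext j
  simp only [mem_freeRows, mem_insert]
  constructor
  · rintro ⟨rfl | rfl | hj, h⟩
    · exact Or.inl rfl
    · exact Or.inr (Or.inl rfl)
    · exact Or.inr (Or.inr ⟨hj, h⟩)
  · rintro (rfl | rfl | ⟨hj, h⟩)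
    · exact ⟨Or.inl rfl, fun p hp => (ha.lt _ (hA.1 p hp).1).ne⟩
    · exact ⟨Or.inr (Or.inl rfl), fun p hp => (ha.neg_lt (hA.1 p hp).1).ne'⟩
    · exact ⟨Or.inr (Or.inr hj), h⟩

theorem IsTower.max_mem_freeRows {G : ℕ → Finset ℤ} {b : ℕ} (hG : IsTower G b) {n : ℕ}
    {A : Finset (ℤ × ℤ)} (hA : IsArcSet (G n) A) : (n : ℤ) + b ∈ freeRows (G n) A := by
  refine mem_freeRows.2 ⟨hG.max_mem n, fun p hp h => ?_⟩
  have := (hG.outer n).bounds hA hp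
  omega

theorem IsOuter.notMem {s : Finset ℤ} {a : ℤ} (ha : IsOuter s a) : a ∉ s ∧ -a ∉ s :=
  ⟨fun h => lt_irrefl _ (ha.lt _ h), fun h => lt_irrefl _ (ha.neg_lt h)⟩

theorem freeRows_subset (s : Finset ℤ) (A : Finset (ℤ × ℤ)) : freeRows s A ⊆ s :=
  filter_subset _ _

/-- The maximum `n + b` is always free and is the only row whose arc to `a` is a cover, with weight
`y`; the statistic counts the other free rows, each of weight `x`. An added arc keeps the count, and
an added pair without arcs raises it by `2`. -/
theorem sum_mirrorArcSets_count {G : ℕ → Finset ℤ} {b : ℕ} (hG : IsTower G b) (x y : R) (n : ℕ) :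
    ∀ f : ℕ → R, ∑ A ∈ mirrorArcSets (G n), arcWeight A x y * f ((freeRows (G n) A).card - 1) =
      ((countOp x + y • 1) ^ n) f ((G 0).card - 1) := by
  induction n with
  | zero =>
    intro f
    rw [hG.base]
    simp [arcWeight, covPairs, freeRows]
  | succ n ih =>
    intro f
    rw [hG.succ, sum_mirrorArcSets_insert (hG.outer n), pow_succ, Module.End.mul_apply, ← ih]
    refine sum_congr rfl fun A hA => ?_
    have hA' := (mem_mirrorArcSets.1 hA).1
    have ho := hG.outer n
    set a := (n : ℤ) + b + 1 with ha
    have hb := fun p hp => ho.bounds hA' (p := p) hp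
    have hm := hG.max_mem_freeRows hA'
    have hpos := card_pos.2 ⟨_, hm⟩
    have hn1 := fun h => ho.notMem.1 (freeRows_subset _ A h)
    have hn2 : -a ∉ freeRows (G n) A := fun h => ho.notMem.2 (freeRows_subset _ A h)
    have hap := ho.pos
    have e : ∀ i ∈ freeRows (G n) A, arcWeight (addPair A i a) x y *
        f ((freeRows (insert a (insert (-a) (G n))) (addPair A i a)).card - 1) =
        (if i = (n : ℤ) + b then y - x else 0) * (arcWeight A x y * f ((freeRows (G n) A).card - 1))
          + x * (arcWeight A x y * f ((freeRows (G n) A).card - 1)) := by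
      intro i hi
      have his := freeRows_subset _ _ hi
      rw [freeRows_addPair ho hA' his,
        card_insert_of_notMem (fun h => hn1 (mem_of_mem_erase h)), card_erase_add_one hi,
        arcWeight_addPair hb (ho.neg_lt his)]
      by_cases h : i = (n : ℤ) + b
      · rw [if_pos h, if_pos (by omega)]
        ring
      · rw [if_neg h, if_neg (by omega)]
        ring
    rw [sum_congr rfl e, sum_add_distrib, ← sum_mul, sum_ite_eq', if_pos hm, sum_const,
      freeRows_insert_neg ho hA', card_insert_of_notMem, card_insert_of_notMem hn2]
    · simp only [LinearMap.add_apply, LinearMap.smul_apply, Module.End.one_apply, Pi.add_apply,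
        Pi.smul_apply, smul_eq_mul, nsmul_eq_mul, countOp_apply]
      obtain ⟨c, hc⟩ : ∃ c, (freeRows (G n) A).card = c + 1 := ⟨_, (Nat.sub_add_cancel hpos).symm⟩
      simp only [hc, Nat.add_sub_cancel, Nat.add_assoc, Nat.reduceAdd]
      push_cast
      ring
    · rw [mem_insert, not_or]
      exact ⟨by omega, hn1⟩

/-! ### Signed partitions: opposite pairs of free rows. -/

/-- The positive elements of `V` whose negative is also in `V`. -/
def paired (V : Finset ℤ) : Finset ℤ := V.filter fun i => 0 < i ∧ -i ∈ V

/-- The elements of `V` that are zero or whose negative is not in `V`. -/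
def unpaired (V : Finset ℤ) : Finset ℤ := V.filter fun i => i = 0 ∨ -i ∉ V

theorem mem_paired {V : Finset ℤ} {i : ℤ} : i ∈ paired V ↔ i ∈ V ∧ 0 < i ∧ -i ∈ V := mem_filter

theorem mem_unpaired {V : Finset ℤ} {i : ℤ} : i ∈ unpaired V ↔ i ∈ V ∧ (i = 0 ∨ -i ∉ V) :=
  mem_filter

theorem sum_paired_add_sum_paired_neg (V : Finset ℤ) (f : ℤ → R) :
    ∑ i ∈ V with i ≠ 0 ∧ -i ∈ V, f i = ∑ i ∈ paired V, f i + ∑ i ∈ paired V, f (-i) := by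
  rw [← sum_filter_add_sum_filter_not _ (fun i => 0 < i)]
  congr 1
  · refine sum_congr ?_ fun _ _ => rfl
    ext i
    simp only [mem_filter, mem_paired]
    constructor
    · rintro ⟨⟨h1, h2, h3⟩, h4⟩
      exact ⟨h1, h4, h3⟩
    · rintro ⟨h1, h2, h3⟩
      exact ⟨⟨h1, h2.ne', h3⟩, h2⟩
  · refine Finset.sum_bij' (fun i _ => -i) (fun i _ => -i) ?_ ?_ ?_ ?_ ?_
    · intro i hi
      simp only [mem_filter, mem_paired, neg_neg] at hi ⊢
      exact ⟨hi.1.2.2, by omega, hi.1.1⟩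
    · intro i hi
      simp only [mem_filter, mem_paired, neg_neg] at hi ⊢
      exact ⟨⟨hi.2.2, by omega, hi.1⟩, by omega⟩
    · simp
    · simp
    · simp

theorem sum_eq_paired_add_unpaired (V : Finset ℤ) (f : ℤ → R) :
    ∑ i ∈ V, f i = ∑ i ∈ paired V, f i + ∑ i ∈ paired V, f (-i) + ∑ i ∈ unpaired V, f i := by
  rw [← sum_paired_add_sum_paired_neg, ← sum_filter_add_sum_filter_not V (fun i => i ≠ 0 ∧ -i ∈ V)]
  congr 2
  ext i
  simp only [mem_filter, unpaired]
  tauto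

theorem paired_insert_neg {V : Finset ℤ} {a : ℤ} (hpos : 0 < a) (ha : a ∉ V) (ha' : -a ∉ V) :
    paired (insert a (insert (-a) V)) = insert a (paired V) ∧
      unpaired (insert a (insert (-a) V)) = unpaired V := by
  constructor
  · ext i
    simp only [mem_paired, mem_insert]
    constructor
    · rintro ⟨rfl | rfl | h, h1, h2⟩
      · exact Or.inl rfl
      · omega
      · rcases h2 with h2 | h2 | h2
        · omega
        · omega
        · exact Or.inr ⟨h, h1, h2⟩
    · rintro (rfl | ⟨h1, h2, h3⟩)
      · exact ⟨Or.inl rfl, hpos, Or.inr (Or.inl rfl)⟩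
      · exact ⟨Or.inr (Or.inr h1), h2, Or.inr (Or.inr h3)⟩
  · ext i
    simp only [mem_unpaired, mem_insert, not_or]
    constructor
    · rintro ⟨rfl | rfl | h, h1⟩
      · omega
      · omega
      · exact ⟨h, h1.imp_right fun h => h.2.2⟩
    · rintro ⟨h1, h2⟩
      refine ⟨Or.inr (Or.inr h1), h2.imp_right fun h => ⟨?_, ?_, h⟩⟩
      · rintro h'
        exact ha' (by rwa [← h', neg_neg])
      · rintro h'
        exact ha (by rwa [← neg_inj.1 h'])

/-- The new row `a` is unpaired because `-a` is absent. If `i` was unpaired, `a` replaces it; if `i`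
had its opposite in `V`, the pair breaks up and both `-i` and `a` end up unpaired. -/
theorem card_paired_insert_erase {V : Finset ℤ} {a i : ℤ} (hpos : 0 < a) (ha : a ∉ V)
    (ha' : -a ∉ V) (hi : i ∈ V) :
    (i ∈ unpaired V → (paired (insert a (V.erase i))).card = (paired V).card ∧
      (unpaired (insert a (V.erase i))).card = (unpaired V).card) ∧
    (i ≠ 0 → -i ∈ V → (paired (insert a (V.erase i))).card = (paired V).card - 1 ∧
      (unpaired (insert a (V.erase i))).card = (unpaired V).card + 2) := by
  have hiaa : i ≠ -a := fun h => ha' (h ▸ hi)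
  have hia : i ≠ a := fun h => ha (h ▸ hi)
  have hp : paired (insert a (V.erase i)) = ((paired V).erase i).erase (-i) := by
    ext j
    simp only [mem_paired, mem_insert, mem_erase]
    constructor
    · rintro ⟨rfl | ⟨h1, h2⟩, h3, h4 | ⟨h4, h5⟩⟩
      · omega
      · exact absurd h5 ha'
      · exact absurd (by rw [← h4, neg_neg]; exact h2) ha'
      · exact ⟨fun h => h4 (by omega), h1, h2, h3, h5⟩
    · rintro ⟨h1, h2, h3, h4, h5⟩
      exact ⟨Or.inr ⟨h2, h3⟩, h4, Or.inr ⟨by omega, h5⟩⟩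
  constructor
  · intro hu
    have hu' := mem_unpaired.1 hu
    have h1 : i ∉ paired V := fun h => by
      obtain ⟨-, h1, h2⟩ := mem_paired.1 h
      rcases hu'.2 with h' | h'
      · omega
      · exact h' h2
    have h2 : -i ∉ paired V := fun h => by
      obtain ⟨h0, h1, h2⟩ := mem_paired.1 h
      rcases hu'.2 with h' | h'
      · omega
      · exact h' h0
    have hU : unpaired (insert a (V.erase i)) = insert a ((unpaired V).erase i) := by
      ext j
      simp only [mem_unpaired, mem_insert, mem_erase, not_or, not_and]
      constructor
      · rintro ⟨rfl | ⟨h1, h2⟩, h3⟩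
        · exact Or.inl rfl
        · refine Or.inr ⟨h1, h2, ?_⟩
          rcases h3 with h3 | h3
          · exact Or.inl h3
          · by_cases hj : -j = i
            · rcases hu'.2 with h | h
              · omega
              · exact absurd (by rw [← hj, neg_neg]; exact h2) h
            · exact Or.inr (h3.2 hj)
      · rintro (rfl | ⟨h1, h2, h3⟩)
        · exact ⟨Or.inl rfl, Or.inr ⟨by omega, fun _ => ha'⟩⟩
        · refine ⟨Or.inr ⟨h1, h2⟩, h3.imp_right fun h => ⟨?_, fun _ => h⟩⟩
          intro h'
          exact ha' (by rwa [← h', neg_neg])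
    rw [hp, erase_eq_of_notMem h1, erase_eq_of_notMem h2, hU, card_insert_of_notMem,
      card_erase_add_one hu]
    · exact ⟨rfl, rfl⟩
    · exact fun h => ha (mem_unpaired.1 (mem_of_mem_erase h)).1
  · intro h0 hni
    have hU : unpaired (insert a (V.erase i)) = insert a (insert (-i) (unpaired V)) := by
      ext j
      simp only [mem_unpaired, mem_insert, mem_erase, not_or, not_and]
      constructor
      · rintro ⟨rfl | ⟨h1, h2⟩, h3⟩
        · exact Or.inl rfl
        · by_cases hj : j = -i
          · exact Or.inr (Or.inl hj)
          · exact Or.inr (Or.inr ⟨h2, h3.imp_right fun h => h.2 (by omega)⟩)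
      · rintro (rfl | rfl | ⟨h1, h2⟩)
        · exact ⟨Or.inl rfl, Or.inr ⟨by omega, fun _ => ha'⟩⟩
        · exact ⟨Or.inr ⟨by omega, hni⟩, Or.inr ⟨by omega, fun h => absurd (neg_neg i) h⟩⟩
        · refine ⟨Or.inr ⟨?_, h1⟩, h2.imp_right fun h => ⟨?_, fun _ => h⟩⟩
          · rintro rfl
            exact h2.elim h0 fun h => h hni
          · intro h'
            exact ha' (by rwa [← h', neg_neg])
    have h1 : -i ∉ unpaired V := fun h => by
      rcases (mem_unpaired.1 h).2 with h | h
      · omega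
      · exact h (by rwa [neg_neg])
    have h2 : a ∉ insert (-i) (unpaired V) := fun h => by
      rcases mem_insert.1 h with h | h
      · omega
      · exact ha (mem_unpaired.1 h).1
    rw [hp, hU, card_insert_of_notMem h2, card_insert_of_notMem h1]
    refine ⟨?_, rfl⟩
    rcases lt_or_gt_of_ne h0 with h | h
    · rw [erase_eq_of_notMem (a := i), card_erase_of_mem]
      · exact mem_paired.2 ⟨hni, by omega, by rwa [neg_neg]⟩
      · exact fun h' => by have := (mem_paired.1 h').2.1; omega
    · rw [erase_eq_of_notMem (a := -i), card_erase_of_mem]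
      · exact mem_paired.2 ⟨hi, h, hni⟩
      · exact fun h' => by have := (mem_paired.1 (mem_of_mem_erase h')).2.1; omega

/-- Either member of one of the `s` pairs can be the partner of `a`, whence `2 * x * s`; an unpaired
partner gives `x * r`. -/
theorem sum_mirrorArcSets_paired {G : ℕ → Finset ℤ} {b : ℕ} (hG : IsTower G b) (x : R) (n : ℕ) :
    ∀ f : ℕ → ℕ → R, ∑ A ∈ mirrorArcSets (G n), x ^ (A.card / 2) *
        f (paired (freeRows (G n) A)).card (unpaired (freeRows (G n) A)).card =
      (bellOp x ^ n) f (paired (G 0)).card (unpaired (G 0)).card := by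
  induction n with
  | zero =>
    intro f
    rw [hG.base]
    simp [freeRows]
  | succ n ih =>
    intro f
    rw [hG.succ, sum_mirrorArcSets_insert (hG.outer n), pow_succ, Module.End.mul_apply, ← ih]
    refine sum_congr rfl fun A hA => ?_
    have hA' := (mem_mirrorArcSets.1 hA).1
    have ho := hG.outer n
    set a := (n : ℤ) + b + 1 with ha
    have hb := fun p hp => ho.bounds hA' (p := p) hp
    have hn1 : a ∉ freeRows (G n) A := fun h => ho.notMem.1 (freeRows_subset _ A h)
    have hn2 : -a ∉ freeRows (G n) A := fun h => ho.notMem.2 (freeRows_subset _ A h)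
    obtain ⟨hp, hu⟩ := paired_insert_neg ho.pos hn1 hn2
    have hcard : ∀ i ∈ freeRows (G n) A, x ^ ((addPair A i a).card / 2) = x ^ (A.card / 2) * x := by
      intro i hi
      rw [card_addPair hb (ho.neg_lt (freeRows_subset _ _ hi)), Nat.add_div_right _ two_pos,
        pow_succ]
    have e1 : ∀ i ∈ freeRows (G n) A, i ≠ 0 → -i ∈ freeRows (G n) A →
        x ^ ((addPair A i a).card / 2) *
          f (paired (freeRows (insert a (insert (-a) (G n))) (addPair A i a))).card
            (unpaired (freeRows (insert a (insert (-a) (G n))) (addPair A i a))).card =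
        x ^ (A.card / 2) * x * f ((paired (freeRows (G n) A)).card - 1)
          ((unpaired (freeRows (G n) A)).card + 2) := by
      intro i hi h0 hni
      rw [hcard i hi, freeRows_addPair ho hA' (freeRows_subset _ _ hi)]
      obtain ⟨h1, h2⟩ := (card_paired_insert_erase ho.pos hn1 hn2 hi).2 h0 hni
      rw [h1, h2]
    have e2 : ∀ i ∈ unpaired (freeRows (G n) A),
        x ^ ((addPair A i a).card / 2) *
          f (paired (freeRows (insert a (insert (-a) (G n))) (addPair A i a))).card
            (unpaired (freeRows (insert a (insert (-a) (G n))) (addPair A i a))).card =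
        x ^ (A.card / 2) * x * f (paired (freeRows (G n) A)).card
          (unpaired (freeRows (G n) A)).card := by
      intro i hi
      have hi' := (mem_unpaired.1 hi).1
      rw [hcard i hi', freeRows_addPair ho hA' (freeRows_subset _ _ hi')]
      obtain ⟨h1, h2⟩ := (card_paired_insert_erase ho.pos hn1 hn2 hi').1 hi
      rw [h1, h2]
    rw [sum_eq_paired_add_unpaired, sum_congr rfl e2,
      sum_congr rfl fun i hi => e1 i (mem_paired.1 hi).1 (mem_paired.1 hi).2.1.ne'
        (mem_paired.1 hi).2.2,
      sum_congr rfl fun i hi => e1 (-i) (mem_paired.1 hi).2.2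
        (neg_ne_zero.2 (mem_paired.1 hi).2.1.ne') (by rw [neg_neg]; exact (mem_paired.1 hi).1),
      freeRows_insert_neg ho hA', hp, hu, card_insert_of_notMem fun h => hn1 (mem_paired.1 h).1,
      bellOp_apply]
    simp only [sum_const, nsmul_eq_mul]
    ring

/-! ### The signed Bell polynomials as operator powers. -/

theorem card_div_two_add {s : Finset ℤ} {Λ : Finpartition s} (h : IsSigned Λ) :
    (arcs Λ \ covs Λ).card / 2 + (covs Λ).card / 2 = (arcs Λ).card / 2 := by
  have h1 := even_card_arcs_sdiff_covs h
  have h2 := even_card_covs h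
  have h3 := card_sdiff_add_card_eq_card (show covs Λ ⊆ arcs Λ from filter_subset _ _)
  rw [Nat.even_iff] at h1 h2
  omega

theorem bellB_eq (x y : R) (n : ℕ) :
    bellB n x y = ((countOp x + y • 1) ^ n) (fun _ => 1) 0 := by
  have h := sum_mirrorArcSets_count isTower_groundB x y n fun _ => 1
  rw [show (groundB 0).card - 1 = 0 by simp [groundB]] at h
  rw [← h, bellB, piB]
  simp only [weight_eq_arcWeight, mul_one]
  exact sum_signed fun A => arcWeight A x y

theorem bellD_eq (x y : R) (n : ℕ) :
    bellD (n + 1) x y = ((countOp x + y • 1) ^ n) (fun _ => 1) 1 := by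
  have h := sum_mirrorArcSets_count isTower_groundD x y n fun _ => 1
  rw [show (groundD (0 + 1)).card - 1 = 1 by decide +kernel] at h
  rw [← h, bellD, piD]
  simp only [weight_eq_arcWeight, mul_one]
  exact sum_signed fun A => arcWeight A x y

theorem card_paired_groundB_zero :
    (paired (groundB 0)).card = 0 ∧ (unpaired (groundB 0)).card = 1 := by
  decide +kernel

/-- With `y = x` covers are not singled out, so the maximum counts as an ordinary free row. The
initial row `0` is then an unpaired one, giving the start `(0, 1)`, the same total as the start `1`
of type D. -/
theorem bellB_diag_eq (x : R) (n : ℕ) : bellB n x x = (bellOp x ^ n) (fun _ _ => 1) 0 1 := by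
  have h := sum_mirrorArcSets_paired isTower_groundB x n fun _ _ => 1
  rw [card_paired_groundB_zero.1, card_paired_groundB_zero.2] at h
  rw [← h, bellB, piB]
  simp only [mul_one]
  rw [← sum_signed fun A => x ^ (A.card / 2)]
  refine sum_congr rfl fun Λ hΛ => ?_
  rw [weight, ← pow_add, card_div_two_add (mem_filter.1 hΛ).2]

/-- If `i` and `-i` are both free, mirror symmetry shows that `i` is not a right end either, so
`{i}` is a block. Conversely, a block whose only nonzero element is `i` cannot contain `0`: the
mirror image of the arc between `0` and `i` would put `-i` in it too. -/
theorem isBFeasible_iff {n : ℕ} {Λ : Finpartition (groundB n)} (hΛ : IsSigned Λ) :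
    IsBFeasible Λ ↔ (paired (freeRows (groundB n) (arcs Λ))).card = 0 := by
  rw [card_eq_zero]
  have hcol : ∀ {p q i : ℤ}, i ∈ paired (freeRows (groundB n) (arcs Λ)) → (p, q) ∈ arcs Λ →
      p ≠ i ∧ q ≠ i := by
    intro p q i hi hp
    obtain ⟨h1, -, h2⟩ := mem_paired.1 hi
    refine ⟨(mem_freeRows.1 h1).2 _ hp, ?_⟩
    rintro rfl
    exact (mem_freeRows.1 h2).2 _ (hΛ _ hp).1 rfl
  constructor
  · intro h
    refine eq_empty_of_forall_notMem fun i hi => ?_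
    obtain ⟨h1, hpos, -⟩ := mem_paired.1 hi
    obtain ⟨b, hb, hib⟩ := Λ.exists_mem (freeRows_subset _ _ h1)
    refine h b hb (card_eq_one.2 ⟨i, ?_⟩)
    ext j
    rw [mem_erase, mem_singleton]
    constructor
    · rintro ⟨-, hj⟩
      rcases lt_trichotomy i j with hij | hij | hij
      · obtain ⟨k, -, hk, -⟩ := exists_arc_right hb hib hj hij
        exact absurd rfl (hcol hi hk).1
      · exact hij.symm
      · obtain ⟨k, -, hk, -⟩ := exists_arc_left hb hj hib hij
        exact absurd rfl (hcol hi hk).2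
    · rintro rfl
      exact ⟨hpos.ne', hib⟩
  · intro h b hb hcard
    obtain ⟨i, hi⟩ := card_eq_one.1 hcard
    have hib : i ≠ 0 ∧ i ∈ b := mem_erase.1 (hi ▸ mem_singleton_self i)
    have hb' : ∀ j ∈ b, j ≠ 0 → j = i := fun j hj h0 =>
      mem_singleton.1 (hi ▸ mem_erase.2 ⟨h0, hj⟩)
    have hfree : ∀ p ∈ arcs Λ, p.1 ≠ i ∧ p.2 ≠ i := by
      rintro ⟨p, q⟩ hp
      have hlt := (mem_arcs_iff.1 hp).1
      refine ⟨?_, ?_⟩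
      · rintro (rfl : p = i)
        have hq := mem_of_arc_left hb hp hib.2
        have hq0 : q = 0 := by
          by_contra h0
          exact absurd (hb' q hq h0) hlt.ne'
        subst hq0
        have h2 := mem_of_arc_left hb (hΛ _ hp).1 (by simpa using hq)
        have := hb' _ h2 (neg_ne_zero.2 hib.1)
        dsimp only at this hlt
        omega
      · rintro (rfl : q = i)
        have hq := mem_of_arc_right hb hp hib.2
        have hq0 : p = 0 := by
          by_contra h0
          exact absurd (hb' p hq h0) hlt.ne
        subst hq0
        have h2 := mem_of_arc_right hb (hΛ _ hp).1 (by simpa using hq)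
        have := hb' _ h2 (neg_ne_zero.2 hib.1)
        dsimp only at this hlt
        omega
    have hfree' : ∀ p ∈ arcs Λ, p.1 ≠ -i := fun p hp h =>
      (hfree _ (hΛ p hp).1).2 (by simp only [h, neg_neg])
    have his := Λ.le hb hib.2
    have hi1 : i ∈ freeRows (groundB n) (arcs Λ) := mem_freeRows.2 ⟨his, fun p hp => (hfree p hp).1⟩
    have hi2 : -i ∈ freeRows (groundB n) (arcs Λ) :=
      mem_freeRows.2 ⟨(isOuter_groundB n).neg_mem _ his, hfree'⟩
    rcases lt_or_gt_of_ne hib.1 with h0 | h0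
    · refine notMem_empty (-i) (h ▸ mem_paired.2 ⟨hi2, by omega, by rwa [neg_neg]⟩)
    · exact notMem_empty i (h ▸ mem_paired.2 ⟨hi1, h0, hi2⟩)

theorem bFeasibleB_eq (x : R) (n : ℕ) : bFeasibleB n x = (bellOp x ^ n) deltaLeft 0 1 := by
  have h := sum_mirrorArcSets_paired isTower_groundB x n deltaLeft
  rw [card_paired_groundB_zero.1, card_paired_groundB_zero.2] at h
  rw [← h, bFeasibleB, piB, ← sum_signed fun A => x ^ (A.card / 2) *
    deltaLeft (paired (freeRows (groundB n) A)).card (unpaired (freeRows (groundB n) A)).card,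
    sum_filter]
  refine sum_congr rfl fun Λ hΛ => ?_
  rw [deltaLeft, mul_ite, mul_one, mul_zero]
  exact if_congr (isBFeasible_iff (mem_filter.1 hΛ).2) rfl rfl

/-! ### Weakly noncrossing partitions: visible rows. -/

/-- The weak noncrossing property of a set of pairs. -/
def IsNC (A : Finset (ℤ × ℤ)) : Prop :=
  ∀ a ∈ A, ∀ b ∈ A, a.1 < b.1 → b.1 < a.2 → a.2 < b.2 → a = (-b.2, -b.1)

/-- The free rows that are not strictly below a pair of `A`. -/
def visible (s : Finset ℤ) (A : Finset (ℤ × ℤ)) : Finset ℤ :=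
  (freeRows s A).filter fun i => ∀ p ∈ A, p.1 < i → p.2 ≤ i

theorem mem_visible {s : Finset ℤ} {A : Finset (ℤ × ℤ)} {i : ℤ} :
    i ∈ visible s A ↔ i ∈ freeRows s A ∧ ∀ p ∈ A, p.1 < i → p.2 ≤ i := mem_filter

theorem visible_subset (s : Finset ℤ) (A : Finset (ℤ × ℤ)) : visible s A ⊆ s :=
  (filter_subset _ _).trans (freeRows_subset _ _)

/-- An old pair crosses `(i, a)` exactly when it passes strictly over `i`, and it cannot be excused
as the mirror image because it does not start at `-a`. -/
theorem isNC_addPair_iff {s : Finset ℤ} {A : Finset (ℤ × ℤ)} {i a : ℤ} (ha : IsOuter s a)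
    (hA : A ∈ mirrorArcSets s) (hi : i ∈ freeRows s A) :
    IsNC (addPair A i a) ↔ IsNC A ∧ i ∈ visible s A := by
  obtain ⟨hA, hm⟩ := mem_mirrorArcSets.1 hA
  have hb := fun p hp => ha.bounds hA (p := p) hp
  have h1 := ha.lt _ (freeRows_subset _ _ hi)
  have h2 := ha.neg_lt (freeRows_subset _ _ hi)
  constructor
  · intro h
    refine ⟨fun p hp q hq => h p (mem_addPair.2 (Or.inr (Or.inr hp))) q
      (mem_addPair.2 (Or.inr (Or.inr hq))), mem_visible.2 ⟨hi, fun p hp hpi => ?_⟩⟩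
    by_contra hlt
    have := h p (mem_addPair.2 (Or.inr (Or.inr hp))) (i, a) (mem_addPair.2 (Or.inl rfl)) hpi
      (not_le.1 hlt) (hb p hp).2.2
    have hp1 := congrArg Prod.fst this
    have := (hb p hp).1
    dsimp only at hp1
    omega
  · rintro ⟨h, hv⟩
    have hv := (mem_visible.1 hv).2
    intro p hp q hq h3 h4 h5
    rcases mem_addPair.1 hp with rfl | rfl | hp <;> rcases mem_addPair.1 hq with rfl | rfl | hq
    · exact absurd h3 (lt_irrefl _)
    · dsimp only at *; omega
    · have := hb q hq; dsimp only at *; omega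
    -- The only crossing allowed: `(-a, -i)` with its mirror image `(i, a)`.
    · rfl
    · exact absurd h3 (lt_irrefl _)
    · have := hv _ (hm q hq).1
      dsimp only at *
      omega
    · have := hv p hp h3
      dsimp only at *
      omega
    · have := hb p hp; dsimp only at *; omega
    · exact h p hp q hq h3 h4 h5

/-- The arc `(i, a)` hides everything between `i` and `a`, and its mirror image everything between
`-a` and `-i`. For `i ≤ 0` nothing but `a` remains visible. -/
theorem visible_addPair {s : Finset ℤ} {A : Finset (ℤ × ℤ)} {i a : ℤ} (ha : IsOuter s a)
    (hA : IsArcSet s A) (hi : i ∈ s) :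
    visible (insert a (insert (-a) s)) (addPair A i a) =
      insert a ((visible s A).filter fun j => -i ≤ j ∧ j < i) := by
  have hb := fun p hp => ha.bounds hA (p := p) hp
  have h1 := ha.lt _ hi
  have h2 := ha.neg_lt hi
  ext j
  rw [mem_visible, freeRows_addPair ha hA hi]
  simp only [mem_insert, mem_filter, mem_visible, mem_erase, addPair, forall_eq_or_imp]
  constructor
  · rintro ⟨rfl | ⟨hji, hj⟩, h3, h4, h5⟩
    · exact Or.inl rfl
    · have h6 := ha.lt _ (freeRows_subset _ _ hj)
      have h7 := ha.neg_lt (freeRows_subset _ _ hj)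
      have h8 := h4 h7
      exact Or.inr ⟨⟨hj, h5⟩, h8, by by_contra h; have := h3 (by omega); omega⟩
  · rintro (rfl | ⟨⟨hj, h3⟩, h4, h5⟩)
    · exact ⟨Or.inl rfl, fun _ => le_rfl, fun _ => by omega, fun p hp _ => (hb p hp).2.2.le⟩
    · exact ⟨Or.inr ⟨h5.ne, hj⟩, fun h => by omega, fun _ => h4, h3⟩

theorem visible_insert_neg {s : Finset ℤ} {A : Finset (ℤ × ℤ)} {a : ℤ} (ha : IsOuter s a)
    (hA : IsArcSet s A) :
    visible (insert a (insert (-a) s)) A = insert a (insert (-a) (visible s A)) := by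
  have hb := fun p hp => ha.bounds hA (p := p) hp
  ext j
  rw [mem_visible, freeRows_insert_neg ha hA]
  simp only [mem_insert, mem_visible]
  constructor
  · rintro ⟨rfl | rfl | h, h'⟩
    · exact Or.inl rfl
    · exact Or.inr (Or.inl rfl)
    · exact Or.inr (Or.inr ⟨h, h'⟩)
  · rintro (rfl | rfl | ⟨h, h'⟩)
    · exact ⟨Or.inl rfl, fun p hp _ => (hb p hp).2.2.le⟩
    · exact ⟨Or.inr (Or.inl rfl), fun p hp h => absurd h (hb p hp).1.not_gt⟩
    · exact ⟨Or.inr (Or.inr h), h'⟩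

theorem visible_empty (s : Finset ℤ) : visible s ∅ = s := by
  simp [visible, freeRows]

open Classical in
/-- The arc sets of the weakly noncrossing signed set partitions of `s`. -/
def ncArcSets (s : Finset ℤ) : Finset (Finset (ℤ × ℤ)) := (mirrorArcSets s).filter IsNC

theorem mem_ncArcSets {s : Finset ℤ} {A : Finset (ℤ × ℤ)} :
    A ∈ ncArcSets s ↔ A ∈ mirrorArcSets s ∧ IsNC A := by
  classical
  rw [ncArcSets, mem_filter]

theorem sum_weaklyNoncrossing {s : Finset ℤ} {M : Type*} [AddCommMonoid M]
    (w : Finset (ℤ × ℤ) → M) :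
    ∑ Λ : Finpartition s with IsSigned Λ ∧ IsWeaklyNoncrossing Λ, w (arcs Λ) =
      ∑ A ∈ ncArcSets s, w A := by
  classical
  rw [ncArcSets, sum_filter (s := mirrorArcSets s), ← sum_signed, ← filter_filter, sum_filter]
  refine sum_congr rfl fun Λ _ => ?_
  exact if_congr Iff.rfl rfl rfl

theorem sum_ncArcSets_insert {s : Finset ℤ} {a : ℤ} (ha : IsOuter s a) {M : Type*}
    [AddCommMonoid M] (w : Finset (ℤ × ℤ) → M) :
    ∑ A ∈ ncArcSets (insert a (insert (-a) s)), w A =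
      ∑ A ∈ ncArcSets s, (w A + ∑ i ∈ visible s A, w (addPair A i a)) := by
  classical
  rw [ncArcSets, ncArcSets, sum_filter, sum_filter, sum_mirrorArcSets_insert ha]
  refine sum_congr rfl fun A hA => ?_
  by_cases h : IsNC A
  · rw [if_pos h, if_pos h, visible, sum_filter]
    congr 1
    refine sum_congr rfl fun i hi => if_congr ?_ rfl rfl
    rw [isNC_addPair_iff ha hA hi, mem_visible]
    exact ⟨fun h => h.2.2, fun h' => ⟨h, hi, h'⟩⟩
  · rw [if_neg h, if_neg h, zero_add]
    exact sum_eq_zero fun i hi => if_neg fun h' => h ((isNC_addPair_iff ha hA hi).1 h').1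

/-- The effect of adding an outermost pair of elements to a weakly noncrossing signed set
partition, on functions of the visible blocks. -/
def ncOp (x : R) : Module.End R (ℕ → ℕ → R) where
  toFun g v e := g (v + 1) e + x * ∑ u ∈ range v, g u e + x * (v + e) * g 0 0
  map_add' g h := by ext v e; simp only [Pi.add_apply, sum_add_distrib]; ring
  map_smul' c g := by
    ext v e
    simp only [Pi.smul_apply, smul_eq_mul, RingHom.id_apply, ← mul_sum]
    ring

theorem ncOp_apply (x : R) (g : ℕ → ℕ → R) (v e : ℕ) :
    ncOp x g v e = g (v + 1) e + x * ∑ u ∈ range v, g u e + x * (v + e) * g 0 0 := rfl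

/-- The rank of an element in `P` takes each value below `P.card` once. -/
theorem sum_card_filter_lt (P : Finset ℤ) (g : ℕ → R) :
    ∑ i ∈ P, g (P.filter (· < i)).card = ∑ u ∈ range P.card, g u := by
  induction P using Finset.induction_on_max with
  | empty => simp
  | insert a P ha ih =>
    have hna : a ∉ P := fun h => lt_irrefl _ (ha a h)
    rw [sum_insert hna, card_insert_of_notMem hna, sum_range_succ, ← ih, add_comm]
    congr 1
    · refine sum_congr rfl fun i hi => ?_
      rw [filter_insert, if_neg (ha i hi).not_gt]
    · rw [filter_insert, if_neg (lt_irrefl _), filter_true_of_mem ha]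

/-- `V` lies between `-m` and its element `m`, there are `v` elements in `[0, m)`, and for each
nonnegative `r` in `V` there are `e` more elements in `[-r, 0)` than in `[0, r)`. -/
structure HasState (V : Finset ℤ) (m : ℤ) (v e : ℕ) : Prop where
  nonneg : 0 ≤ m
  mem : m ∈ V
  bounds : ∀ j ∈ V, -m ≤ j ∧ j ≤ m
  card_eq : (V.filter fun j => 0 ≤ j ∧ j < m).card = v
  balanced : ∀ r ∈ V, 0 ≤ r →
    (V.filter fun j => -r ≤ j ∧ j < 0).card = (V.filter fun j => 0 ≤ j ∧ j < r).card + e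

theorem HasState.card_neg {V : Finset ℤ} {m : ℤ} {v e : ℕ} (h : HasState V m v e) :
    (V.filter (· < 0)).card = v + e := by
  rw [← h.card_eq, ← h.balanced m h.mem h.nonneg]
  congr 1
  refine filter_congr fun j hj => ?_
  exact ⟨fun h' => ⟨(h.bounds j hj).1, h'⟩, fun h' => h'.2⟩

/-- The value of `v + e` in `HasState V m v e` minus that of `v`. -/
def excess (V : Finset ℤ) (m : ℤ) : ℕ :=
  (V.filter (· < 0)).card - (V.filter fun j => 0 ≤ j ∧ j < m).card

theorem HasState.excess_eq {V : Finset ℤ} {m : ℤ} {v e : ℕ} (h : HasState V m v e) :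
    excess V m = e := by
  rw [excess, h.card_neg, h.card_eq, Nat.add_sub_cancel_left]

theorem HasState.insert_neg {V : Finset ℤ} {m : ℤ} {v e : ℕ} (h : HasState V m v e) :
    HasState (insert (m + 1) (insert (-(m + 1)) V)) (m + 1) (v + 1) e := by
  have h0 := h.nonneg
  have hsplit : (V.filter fun j => 0 ≤ j ∧ j < m + 1).card = v + 1 := by
    rw [← h.card_eq, ← card_insert_of_notMem (s := V.filter fun j => 0 ≤ j ∧ j < m) (a := m)
      (by simp)]
    congr 1
    ext j
    simp only [mem_filter, mem_insert]
    have := h.mem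
    constructor
    · rintro ⟨h1, h2, h3⟩
      by_cases hj : j = m
      · exact Or.inl hj
      · exact Or.inr ⟨h1, h2, by omega⟩
    · rintro (rfl | ⟨h1, h2, h3⟩)
      · exact ⟨this, by omega⟩
      · exact ⟨h1, by omega⟩
  have hcard : ((insert (m + 1) (insert (-(m + 1)) V)).filter
      fun j => 0 ≤ j ∧ j < m + 1).card = v + 1 := by
    rw [filter_insert, filter_insert, if_neg (by omega), if_neg (by omega), hsplit]
  refine ⟨by omega, mem_insert_self _ _, ?_, hcard, ?_⟩
  · intro j hj
    rcases mem_insert.1 hj with rfl | hj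
    · omega
    · rcases mem_insert.1 hj with rfl | hj
      · omega
      · have := h.bounds j hj
        omega
  · intro r hr hr0
    rcases mem_insert.1 hr with rfl | hr
    · rw [hcard, filter_insert, filter_insert, if_neg (by omega), if_pos (by omega),
        card_insert_of_notMem]
      · rw [show (V.filter fun j => -(m + 1) ≤ j ∧ j < 0) = V.filter (· < 0) from
          filter_congr fun j hj => ⟨fun h' => h'.2, fun h' => ⟨by
            have := h.bounds j hj
            omega, h'⟩⟩, h.card_neg]
        omega
      · intro h'
        have := h.bounds _ (mem_filter.1 h').1
        omega
    · rcases mem_insert.1 hr with rfl | hr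
      · omega
      · have := h.bounds r hr
        rw [filter_insert, filter_insert, if_neg (by omega), if_neg (by omega), filter_insert,
          filter_insert, if_neg (by omega), if_neg (by omega)]
        exact h.balanced r hr hr0

/-- Cutting down to `[-i, i)` does not change the windows `[-r, 0)` and `[0, r)` for `r ≤ i`, so the
excess `e` is inherited. This is why `balanced` is demanded at every visible `r` and not only at
`m`. -/
theorem HasState.insert_filter {V : Finset ℤ} {m : ℤ} {v e : ℕ} (h : HasState V m v e) {i : ℤ}
    (hi : i ∈ V) (hi0 : 0 ≤ i) :
    HasState (insert (m + 1) (V.filter fun j => -i ≤ j ∧ j < i)) (m + 1)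
      (V.filter fun j => 0 ≤ j ∧ j < i).card e := by
  have hb := h.bounds i hi
  have h1 : ∀ r, r ≤ i → (V.filter fun j => -i ≤ j ∧ j < i).filter (fun j => 0 ≤ j ∧ j < r) =
      V.filter fun j => 0 ≤ j ∧ j < r := by
    intro r hr
    rw [filter_filter]
    exact filter_congr fun j _ => by omega
  have h2 : ∀ r, r ≤ i → 0 ≤ r →
      (V.filter fun j => -i ≤ j ∧ j < i).filter (fun j => -r ≤ j ∧ j < 0) =
      V.filter fun j => -r ≤ j ∧ j < 0 := by
    intro r hr hr0
    rw [filter_filter]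
    exact filter_congr fun j _ => by omega
  have hcard : ((insert (m + 1) (V.filter fun j => -i ≤ j ∧ j < i)).filter
      fun j => 0 ≤ j ∧ j < m + 1).card = (V.filter fun j => 0 ≤ j ∧ j < i).card := by
    rw [filter_insert, if_neg (by omega), ← h1 i le_rfl]
    congr 1
    refine filter_congr fun j hj => ?_
    have := (mem_filter.1 hj).2
    omega
  refine ⟨by omega, mem_insert_self _ _, ?_, hcard, ?_⟩
  · intro j hj
    rcases mem_insert.1 hj with rfl | hj
    · omega
    · have := (mem_filter.1 hj).2
      omega
  · intro r hr hr0
    rcases mem_insert.1 hr with rfl | hr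
    · rw [hcard, filter_insert, if_neg (by omega), ← h.balanced i hi hi0, ← h2 i le_rfl hi0]
      congr 1
      refine filter_congr fun j hj => ?_
      have := (mem_filter.1 hj).2
      omega
    · obtain ⟨hr, hr'⟩ := mem_filter.1 hr
      rw [filter_insert, filter_insert, if_neg (by omega), if_neg (by omega), h1 r (by omega),
        h2 r (by omega) hr0]
      exact h.balanced r hr hr0

theorem filter_neg_le_eq_empty (V : Finset ℤ) {i : ℤ} (hi : i ≤ 0) :
    (V.filter fun j => -i ≤ j ∧ j < i) = ∅ :=
  filter_eq_empty_iff.2 fun j _ => by omega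

theorem hasState_singleton {m : ℤ} (hm : 0 ≤ m) : HasState {m} m 0 0 := by
  refine ⟨hm, mem_singleton_self m, ?_, ?_, ?_⟩
  · intro j hj
    rw [mem_singleton] at hj
    omega
  · rw [card_eq_zero, filter_eq_empty_iff]
    intro j hj
    rw [mem_singleton] at hj
    omega
  · intro r hr hr0
    rw [mem_singleton.1 hr, filter_singleton, filter_singleton, if_neg (by omega),
      if_neg (by omega)]
    rfl

theorem HasState.insert_filter_neg {V : Finset ℤ} {m : ℤ} {v e : ℕ} (h : HasState V m v e) {i : ℤ}
    (hi : i < 0) : HasState (insert (m + 1) (V.filter fun j => -i ≤ j ∧ j < i)) (m + 1) 0 0 := by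
  rw [filter_neg_le_eq_empty V hi.le, insert_empty_eq]
  exact hasState_singleton (by have := h.nonneg; omega)

theorem exists_hasState {G : ℕ → Finset ℤ} {b e₀ : ℕ} (hG : IsTower G b)
    (h0 : HasState (G 0) b 0 e₀) (n : ℕ) :
    ∀ A ∈ ncArcSets (G n), ∃ v e, HasState (visible (G n) A) (n + b) v e := by
  classical
  induction n with
  | zero =>
    intro A hA
    have := (mem_ncArcSets.1 hA).1
    rw [hG.base, mem_singleton] at this
    subst this
    rw [visible_empty, Nat.cast_zero, zero_add]
    exact ⟨_, _, h0⟩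
  | succ n ih =>
    -- The recursion is reused as an induction principle: summing the indicator of failure, with
    -- values in `ℕ`, gives `0`, so no arc set fails.
    have key := sum_ncArcSets_insert (hG.outer n) (fun A =>
      if ∃ v e, HasState (visible (G (n + 1)) A) ((n + 1 : ℕ) + b) v e then 0 else 1)
    rw [← hG.succ, sum_eq_zero (s := ncArcSets (G n)), sum_eq_zero_iff] at key
    · intro A hA
      by_contra hcon
      exact absurd (key A hA) (by rw [if_neg hcon]; exact one_ne_zero)
    · intro A hA
      have hA' := (mem_mirrorArcSets.1 (mem_ncArcSets.1 hA).1).1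
      obtain ⟨v, e, h⟩ := ih A hA
      have hm : ((n + 1 : ℕ) : ℤ) + b = n + b + 1 := by push_cast; ring
      rw [hm, hG.succ, visible_insert_neg (hG.outer n) hA', if_pos ⟨_, _, h.insert_neg⟩, zero_add]
      refine sum_eq_zero fun i hi => ?_
      rw [visible_addPair (hG.outer n) hA' (visible_subset _ _ hi)]
      rcases lt_or_ge i 0 with hi0 | hi0
      · exact if_pos ⟨_, _, h.insert_filter_neg hi0⟩
      · exact if_pos ⟨_, _, h.insert_filter hi hi0⟩

/-- The partner `i` of the new maximum falls into three classes: the `v + e` negative rows reset the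
state to `(0, 0)`; a row in `[0, m)` of rank `u` leads to `(u, e)`; and `m` itself is the cover, of
weight `y`, leaving the state unchanged. -/
theorem sum_ncArcSets {G : ℕ → Finset ℤ} {b e₀ : ℕ} (hG : IsTower G b)
    (h0 : HasState (G 0) b 0 e₀) (x y : R) (n : ℕ) :
    ∀ f : ℕ → ℕ → R, ∑ A ∈ ncArcSets (G n), arcWeight A x y *
        f ((visible (G n) A).filter fun j => 0 ≤ j ∧ j < (n : ℤ) + b).card
          (excess (visible (G n) A) (n + b)) =
      ((ncOp x + y • 1) ^ n) f 0 e₀ := by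
  induction n with
  | zero =>
    intro f
    have : ncArcSets (G 0) = {∅} := by
      ext A
      rw [mem_ncArcSets, hG.base, mem_singleton, and_iff_left_iff_imp]
      rintro rfl
      simp [IsNC]
    rw [this, sum_singleton, visible_empty, Nat.cast_zero, zero_add, h0.card_eq, h0.excess_eq]
    simp [arcWeight, covPairs]
  | succ n ih =>
    intro f
    have ho := hG.outer n
    have hm : ((n + 1 : ℕ) : ℤ) + b = n + b + 1 := by push_cast; ring
    rw [hm, hG.succ, sum_ncArcSets_insert ho, pow_succ, Module.End.mul_apply, ← ih]
    refine sum_congr rfl fun A hA => ?_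
    have hA' := (mem_mirrorArcSets.1 (mem_ncArcSets.1 hA).1).1
    obtain ⟨v, e, h⟩ := exists_hasState hG h0 n A hA
    have hb := fun p hp => ho.bounds hA' (p := p) hp
    set V := visible (G n) A with hV
    set m := (n : ℤ) + b with hmdef
    have hw : ∀ i ∈ V, arcWeight (addPair A i (m + 1)) x y =
        (if i = m then y else x) * arcWeight A x y := fun i hi => by
      rw [arcWeight_addPair hb (ho.neg_lt (visible_subset _ _ hi))]
      exact congrArg (· * _) (if_congr (by omega) rfl rfl)
    have hvis : ∀ i ∈ V, visible (insert (m + 1) (insert (-(m + 1)) (G n))) (addPair A i (m + 1)) =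
        insert (m + 1) (V.filter fun j => -i ≤ j ∧ j < i) := fun i hi =>
      visible_addPair ho hA' (visible_subset _ _ hi)
    rw [visible_insert_neg ho hA', h.insert_neg.card_eq, h.insert_neg.excess_eq, h.card_eq,
      h.excess_eq, ← sum_filter_add_sum_filter_not V (· < 0),
      ← sum_filter_add_sum_filter_not (V.filter fun i => ¬ i < 0) (· < m), filter_filter,
      filter_filter]
    have hsm : (V.filter fun i => ¬ i < 0 ∧ ¬ i < m) = {m} := by
      ext j
      rw [mem_filter, mem_singleton]
      constructor
      · rintro ⟨h1, h2, h3⟩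
        have := h.bounds j h1
        omega
      · rintro rfl
        exact ⟨h.mem, by have := h.nonneg; omega⟩
    have hsp : (V.filter fun i => ¬ i < 0 ∧ i < m) = V.filter fun i => 0 ≤ i ∧ i < m :=
      filter_congr fun j _ => by omega
    have hneg : ∑ i ∈ V with i < 0, arcWeight (addPair A i (m + 1)) x y *
        f ((visible (insert (m + 1) (insert (-(m + 1)) (G n))) (addPair A i (m + 1))).filter
          fun j => 0 ≤ j ∧ j < m + 1).card
          (excess (visible (insert (m + 1) (insert (-(m + 1)) (G n))) (addPair A i (m + 1)))
            (m + 1)) = (v + e : ℕ) * (x * arcWeight A x y * f 0 0) := by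
      rw [← h.card_neg, ← nsmul_eq_mul, ← sum_const]
      refine sum_congr rfl fun i hi => ?_
      obtain ⟨hi, hi0⟩ := mem_filter.1 hi
      have hst := h.insert_filter_neg hi0
      rw [hw i hi, hvis i hi, hst.card_eq, hst.excess_eq,
        if_neg (by have := h.nonneg; omega)]
    have hnn : ∀ i ∈ V, 0 ≤ i → arcWeight (addPair A i (m + 1)) x y *
        f ((visible (insert (m + 1) (insert (-(m + 1)) (G n))) (addPair A i (m + 1))).filter
          fun j => 0 ≤ j ∧ j < m + 1).card
          (excess (visible (insert (m + 1) (insert (-(m + 1)) (G n))) (addPair A i (m + 1)))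
            (m + 1)) = (if i = m then y else x) * arcWeight A x y *
              f (V.filter fun j => 0 ≤ j ∧ j < i).card e := by
      intro i hi hi0
      have hst := h.insert_filter hi hi0
      rw [hw i hi, hvis i hi, hst.card_eq, hst.excess_eq]
    have hpos : ∑ i ∈ V with 0 ≤ i ∧ i < m, arcWeight (addPair A i (m + 1)) x y *
        f ((visible (insert (m + 1) (insert (-(m + 1)) (G n))) (addPair A i (m + 1))).filter
          fun j => 0 ≤ j ∧ j < m + 1).card
          (excess (visible (insert (m + 1) (insert (-(m + 1)) (G n))) (addPair A i (m + 1)))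
            (m + 1)) = x * arcWeight A x y * ∑ u ∈ range v, f u e := by
      have := sum_card_filter_lt (V.filter fun i => 0 ≤ i ∧ i < m) (fun u => f u e)
      rw [h.card_eq] at this
      rw [← this, mul_sum]
      refine sum_congr rfl fun i hi => ?_
      obtain ⟨hi, hi0, him⟩ := mem_filter.1 hi
      rw [hnn i hi hi0, if_neg him.ne, filter_filter]
      congr 3
      exact filter_congr fun j _ => by omega
    rw [hneg, hsm, hsp, hpos, sum_singleton, hnn m h.mem h.nonneg, if_pos rfl, h.card_eq]
    simp only [LinearMap.add_apply, LinearMap.smul_apply, Module.End.one_apply, Pi.add_apply,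
      Pi.smul_apply, smul_eq_mul, ncOp_apply]
    push_cast
    ring

theorem catB_eq (x y : R) (n : ℕ) :
    catB n x y = ((ncOp x + y • 1) ^ n) (fun _ _ => 1) 0 0 := by
  have h0 : HasState (groundB 0) (0 : ℕ) 0 0 := by
    have : groundB 0 = {0} := by decide +kernel
    rw [this]
    exact hasState_singleton le_rfl
  rw [← sum_ncArcSets isTower_groundB h0 x y n, catB, ncB, piB, filter_filter]
  simp only [weight_eq_arcWeight, mul_one]
  exact sum_weaklyNoncrossing fun A => arcWeight A x y

theorem catD_eq (x y : R) (n : ℕ) :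
    catD (n + 1) x y = ((ncOp x + y • 1) ^ n) (fun _ _ => 1) 0 1 := by
  -- In `{-1, 1}` the negative row has no counterpart in `[0, 1)`, so the excess is `1`.
  have h0 : HasState (groundD (0 + 1)) (1 : ℕ) 0 1 := by
    refine ⟨?_, ?_, ?_, ?_, ?_⟩ <;> decide +kernel
  rw [← sum_ncArcSets isTower_groundD h0 x y n, catD, ncD, piD, filter_filter]
  simp only [weight_eq_arcWeight, mul_one]
  exact sum_weaklyNoncrossing fun A => arcWeight A x y

/-! ### Poor partitions: visible opposite pairs. -/

/-- No two pairs of `A` are consecutive, except possibly at `0` if `z` holds. -/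
def IsPoorArcs (z : Prop) (A : Finset (ℤ × ℤ)) : Prop :=
  ∀ p ∈ A, ∀ q ∈ A, p.2 = q.1 → z ∧ p.2 = 0

/-- New consecutive pairs can meet only at `i` or `-i`, since `±a` are extreme. An old pair ending
at `i` is the mirror image of one starting at `-i`, so freeness of `-i` excludes both; for `i = 0`
the two added pairs meet each other. -/
theorem isPoorArcs_addPair_iff {s : Finset ℤ} {A : Finset (ℤ × ℤ)} {i a : ℤ} {z : Prop}
    (ha : IsOuter s a) (hA : A ∈ mirrorArcSets s) (hi : i ∈ freeRows s A) :
    IsPoorArcs z (addPair A i a) ↔ IsPoorArcs z A ∧ -i ∈ freeRows s A ∧ (i = 0 → z) := by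
  obtain ⟨hA, hm⟩ := mem_mirrorArcSets.1 hA
  have hb := fun p hp => ha.bounds hA (p := p) hp
  have h1 := ha.lt _ (freeRows_subset _ _ hi)
  have h2 := ha.neg_lt (freeRows_subset _ _ hi)
  have hr := (mem_freeRows.1 hi).2
  have hl : (i, a) ∈ addPair A i a := mem_addPair.2 (Or.inl rfl)
  have hl' : (-a, -i) ∈ addPair A i a := mem_addPair.2 (Or.inr (Or.inl rfl))
  have hsub : ∀ p ∈ A, p ∈ addPair A i a := fun p hp => mem_addPair.2 (Or.inr (Or.inr hp))
  constructor
  · intro h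
    refine ⟨fun p hp q hq => h p (hsub p hp) q (hsub q hq), mem_freeRows.2
      ⟨ha.neg_mem _ (freeRows_subset _ _ hi), fun p hp hpi => ?_⟩, ?_⟩
    · have := (h _ hl' p (hsub p hp) hpi.symm).2
      dsimp only at this
      exact hr p hp (by omega)
    · rintro rfl
      exact (h _ hl' _ hl (by simp)).1
  · rintro ⟨h, hni, hz⟩ p hp q hq hpq
    rw [mem_freeRows] at hni
    rcases mem_addPair.1 hp with rfl | rfl | hp <;> rcases mem_addPair.1 hq with rfl | rfl | hq
    · dsimp only at hpq; omega
    · dsimp only at hpq; omega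
    · have := hb q hq; dsimp only at hpq; omega
    · dsimp only at hpq ⊢
      exact ⟨hz (by omega), by omega⟩
    · dsimp only at hpq; omega
    · exact absurd hpq.symm (hni.2 q hq)
    · exact absurd (by dsimp only at hpq ⊢; omega) (hni.2 _ (hm p hp).1)
    · have := hb p hp; dsimp only at hpq; omega
    · exact h p hp q hq hpq

/-- A pair passing strictly over `-i` has a mirror image passing strictly over `i`. -/
theorem neg_mem_visible {s : Finset ℤ} {A : Finset (ℤ × ℤ)} {i : ℤ} (hm : IsMirror A)
    (hi : i ∈ visible s A) : -i ∈ freeRows s A ↔ -i ∈ visible s A := by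
  rw [mem_visible, iff_self_and]
  intro h p hp hpi
  by_contra hlt
  obtain ⟨h1, h2⟩ := mem_visible.1 hi
  have h3 := h2 _ (hm p hp).1
  dsimp only at h3
  have h4 : p.1 = -i := by omega
  exact (mem_freeRows.1 h).2 p hp h4

open Classical in
/-- The arc sets of the weakly noncrossing signed set partitions of `s` without consecutive arcs,
except possibly at `0` if `z` holds. -/
def poorArcSets (z : Prop) (s : Finset ℤ) : Finset (Finset (ℤ × ℤ)) :=
  (ncArcSets s).filter (IsPoorArcs z)

theorem mem_poorArcSets {z : Prop} {s : Finset ℤ} {A : Finset (ℤ × ℤ)} :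
    A ∈ poorArcSets z s ↔ A ∈ ncArcSets s ∧ IsPoorArcs z A := by
  classical
  rw [poorArcSets, mem_filter]

open Classical in
theorem sum_poorArcSets_insert (z : Prop) {s : Finset ℤ} {a : ℤ} (ha : IsOuter s a)
    (w : Finset (ℤ × ℤ) → R) :
    ∑ A ∈ poorArcSets z (insert a (insert (-a) s)), w A =
      ∑ A ∈ poorArcSets z s, (w A +
        (∑ i ∈ paired (visible s A), w (addPair A i a) +
          ∑ i ∈ paired (visible s A), w (addPair A (-i) a) +
          if z ∧ 0 ∈ visible s A then w (addPair A 0 a) else 0)) := by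
  rw [poorArcSets, poorArcSets, sum_filter, sum_filter, sum_ncArcSets_insert ha]
  refine sum_congr rfl fun A hA => ?_
  have hA' := (mem_ncArcSets.1 hA).1
  have hfree : ∀ i ∈ visible s A, i ∈ freeRows s A := fun i hi => (mem_visible.1 hi).1
  by_cases h : IsPoorArcs z A
  · rw [if_pos h, if_pos h]
    congr 1
    rw [← sum_paired_add_sum_paired_neg (visible s A) fun i => w (addPair A i a),
      ← sum_filter_add_sum_filter_not (visible s A) (fun i => i ≠ 0),
      sum_filter (p := fun i => i ≠ 0 ∧ _), sum_filter (p := fun i => i ≠ 0)]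
    congr 1
    · refine sum_congr rfl fun i hi => ?_
      rw [isPoorArcs_addPair_iff ha hA' (hfree i hi),
        neg_mem_visible (mem_mirrorArcSets.1 hA').2 hi]
      by_cases h0 : i = 0
      · simp [h0]
      · simp [h0, h]
    · have hs : ((visible s A).filter fun i => ¬ i ≠ 0) = if 0 ∈ visible s A then {0} else ∅ := by
        ext i
        rw [mem_filter]
        split_ifs with h0
        · rw [mem_singleton]
          constructor
          · rintro ⟨-, h⟩
            omega
          · rintro rfl
            exact ⟨h0, by omega⟩
        · refine iff_of_false ?_ (notMem_empty i)
          rintro ⟨h1, h2⟩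
          obtain rfl : i = 0 := by omega
          exact h0 h1
      rw [hs]
      by_cases h0 : 0 ∈ visible s A
      · have hiff := isPoorArcs_addPair_iff (z := z) ha hA' (hfree 0 h0)
        rw [neg_zero] at hiff
        rw [if_pos h0, sum_singleton]
        exact if_congr (hiff.trans ⟨fun h' => ⟨h'.2.2 rfl, h0⟩,
          fun h' => ⟨h, hfree 0 h0, fun _ => h'.1⟩⟩) rfl rfl
      · rw [if_neg h0, sum_empty, if_neg fun h' => h0 h'.2]
  · rw [if_neg h, if_neg h, zero_add]
    exact sum_eq_zero fun i hi => if_neg fun h' =>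
      h ((isPoorArcs_addPair_iff ha hA' (hfree i hi)).1 h').1

/-- The window `[-i, i)` keeps both members of each pair `±j` with `j < i`; its left end `-i`, if
kept, has lost its opposite. -/
theorem paired_insert_filter {V : Finset ℤ} {a i : ℤ} (hpos : 0 < a) (ha : -a ∉ V) :
    paired (insert a (V.filter fun j => -i ≤ j ∧ j < i)) = (paired V).filter (· < i) := by
  ext j
  simp only [mem_paired, mem_insert, mem_filter]
  constructor
  · rintro ⟨rfl | h1, h2, h3 | h3⟩
    · omega
    · exact absurd h3.1 ha
    · omega
    · exact ⟨⟨h1.1, h2, h3.1⟩, h1.2.2⟩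
  · rintro ⟨⟨h1, h2, h3⟩, h4⟩
    exact ⟨Or.inr ⟨h1, by omega, h4⟩, h2, Or.inr ⟨h3, by omega, by omega⟩⟩

open Classical in
-- This is `ncOp` again, with the visible pairs as first variable and the indicator of a usable
-- visible `0` as second. The positive member of a pair keeps the smaller pairs and the `0`; a
-- negative member, or `0` itself, resets the state to `(0, 0)`.
theorem sum_poorArcSets {G : ℕ → Finset ℤ} {b : ℕ} (hG : IsTower G b) (z : Prop) (x : R) (n : ℕ) :
    ∀ f : ℕ → ℕ → R, ∑ A ∈ poorArcSets z (G n), x ^ (A.card / 2) *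
        f (paired (visible (G n) A)).card (if z ∧ 0 ∈ visible (G n) A then 1 else 0) =
      (ncOp x ^ n) f (paired (G 0)).card (if z ∧ 0 ∈ G 0 then 1 else 0) := by
  induction n with
  | zero =>
    intro f
    have : poorArcSets z (G 0) = {∅} := by
      ext A
      rw [mem_poorArcSets, mem_ncArcSets, hG.base, mem_singleton]
      constructor
      · exact fun h => h.1.1
      · rintro rfl
        simp [IsNC, IsPoorArcs]
    rw [this, sum_singleton, visible_empty]
    simp
  | succ n ih =>
    intro f
    have ho := hG.outer n
    rw [hG.succ, sum_poorArcSets_insert z ho, pow_succ, Module.End.mul_apply, ← ih]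
    refine sum_congr rfl fun A hA => ?_
    have hA' := (mem_mirrorArcSets.1 (mem_ncArcSets.1 (mem_poorArcSets.1 hA).1).1).1
    have hb := fun p hp => ho.bounds hA' (p := p) hp
    set a := (n : ℤ) + b + 1 with ha
    have hn1 : a ∉ visible (G n) A := fun h => ho.notMem.1 (visible_subset _ A h)
    have hn2 : -a ∉ visible (G n) A := fun h => ho.notMem.2 (visible_subset _ A h)
    have hvis : ∀ i ∈ visible (G n) A, visible (insert a (insert (-a) (G n))) (addPair A i a) =
        insert a ((visible (G n) A).filter fun j => -i ≤ j ∧ j < i) := fun i hi =>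
      visible_addPair ho hA' (visible_subset _ _ hi)
    have hcard : ∀ i ∈ visible (G n) A, x ^ ((addPair A i a).card / 2) = x ^ (A.card / 2) * x := by
      intro i hi
      rw [card_addPair hb (ho.neg_lt (visible_subset _ _ hi)), Nat.add_div_right _ two_pos,
        pow_succ]
    rw [visible_insert_neg ho hA']
    generalize hV : visible (G n) A = V at *
    have ha0 := ho.pos
    have h0 : (if z ∧ 0 ∈ insert a (insert (-a) V) then 1 else 0) =
        if z ∧ 0 ∈ V then 1 else 0 := by
      refine if_congr (and_congr_right fun _ => ?_) rfl rfl
      rw [mem_insert, mem_insert, or_iff_right (by omega), or_iff_right (by omega)]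
    have epos : ∀ i ∈ paired V, x ^ ((addPair A i a).card / 2) *
        f (paired (visible (insert a (insert (-a) (G n))) (addPair A i a))).card
          (if z ∧ 0 ∈ visible (insert a (insert (-a) (G n))) (addPair A i a) then 1 else 0) =
        x ^ (A.card / 2) * x *
          f ((paired V).filter (· < i)).card (if z ∧ 0 ∈ V then 1 else 0) := by
      intro i hi
      obtain ⟨hi, hi0, -⟩ := mem_paired.1 hi
      rw [hcard i hi, hvis i hi, paired_insert_filter ho.pos hn2]
      congr 2
      refine if_congr (and_congr_right fun _ => ?_) rfl rfl
      rw [mem_insert, or_iff_right ho.pos.ne, mem_filter, and_iff_left]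
      omega
    have eneg : ∀ i ∈ V, i ≤ 0 → x ^ ((addPair A i a).card / 2) *
        f (paired (visible (insert a (insert (-a) (G n))) (addPair A i a))).card
          (if z ∧ 0 ∈ visible (insert a (insert (-a) (G n))) (addPair A i a) then 1 else 0) =
        x ^ (A.card / 2) * x * f 0 0 := by
      intro i hi hi0
      rw [hcard i hi, hvis i hi, paired_insert_filter ho.pos hn2, filter_neg_le_eq_empty V hi0,
        if_neg, filter_false_of_mem, card_empty]
      · intro j hj
        have := (mem_paired.1 hj).2.1
        omega
      · rw [insert_empty_eq, mem_singleton]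
        exact fun h => ho.pos.ne h.2
    have ezero : (if z ∧ 0 ∈ V then x ^ ((addPair A 0 a).card / 2) *
        f (paired (visible (insert a (insert (-a) (G n))) (addPair A 0 a))).card
          (if z ∧ 0 ∈ visible (insert a (insert (-a) (G n))) (addPair A 0 a) then 1 else 0)
        else 0) =
        ((if z ∧ 0 ∈ V then 1 else 0 : ℕ) : R) * (x ^ (A.card / 2) * x * f 0 0) := by
      by_cases h : z ∧ 0 ∈ V
      · rw [if_pos h, if_pos h, eneg 0 h.2 le_rfl, Nat.cast_one, one_mul]
      · rw [if_neg h, if_neg h, Nat.cast_zero, zero_mul]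
    rw [ezero, sum_congr rfl epos, sum_congr rfl fun i hi => eneg (-i) (mem_paired.1 hi).2.2
      (by have := (mem_paired.1 hi).2.1; omega), ← mul_sum,
      sum_card_filter_lt (paired V) fun u => f u _, sum_const, nsmul_eq_mul, h0,
      (paired_insert_neg ho.pos hn1 hn2).1, card_insert_of_notMem fun h => hn1 (mem_paired.1 h).1,
      ncOp_apply]
    ring

/-- Any element of `c` other than its minimum and maximum has neighbours on both sides in `b`. -/
theorem exists_consecutive_arcs {s : Finset ℤ} {Λ : Finpartition s} {b c : Finset ℤ}
    (hb : b ∈ Λ.parts) (hcb : c ⊆ b) (hc : 2 < c.card) :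
    ∃ i ∈ b, ∃ j ∈ c, ∃ k ∈ b, (i, j) ∈ arcs Λ ∧ (j, k) ∈ arcs Λ := by
  have hne : c.Nonempty := card_pos.1 (by omega)
  obtain ⟨l, hl, hmin⟩ := exists_min_image c id hne
  obtain ⟨u, hu, hmax⟩ := exists_max_image c id hne
  have h2 : 0 < ((c.erase l).erase u).card := by
    have h1 := pred_card_le_card_erase (s := c) (a := l)
    have h2 := pred_card_le_card_erase (s := c.erase l) (a := u)
    omega
  obtain ⟨j, hj⟩ := card_pos.1 h2
  simp only [mem_erase] at hj
  obtain ⟨hju, hjl, hj⟩ := hj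
  obtain ⟨i, hi, hij, -⟩ := exists_arc_left hb (hcb hl) (hcb hj)
    (lt_of_le_of_ne (hmin j hj) (Ne.symm hjl))
  obtain ⟨k, hk, hjk, -⟩ := exists_arc_right hb (hcb hj) (hcb hu) (lt_of_le_of_ne (hmax j hj) hju)
  exact ⟨i, hi, j, hj, k, hk, hij, hjk⟩

theorem isPoor_iff {s : Finset ℤ} (Λ : Finpartition s) :
    IsPoor Λ ↔ IsPoorArcs False (arcs Λ) := by
  constructor
  · rintro h ⟨i, j⟩ hij ⟨j', k⟩ hjk (rfl : j = j')
    exfalso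
    obtain ⟨h1, b, hb, hib, hjb, -⟩ := mem_arcs_iff.1 hij
    have h2 := (mem_arcs_iff.1 hjk).1
    have := two_lt_card.2 ⟨i, hib, j, hjb, k, mem_of_arc_left hb hjk hjb, h1.ne, (h1.trans h2).ne,
      h2.ne⟩
    exact absurd (h b hb) this.not_ge
  · intro h b hb
    by_contra hlt
    obtain ⟨i, -, j, -, k, -, hij, hjk⟩ := exists_consecutive_arcs hb subset_rfl (not_le.1 hlt)
    exact (h _ hij _ hjk rfl).1

/-- If arcs meet at `j ≠ 0` and one of the outer ends is `0`, the mirror image of the arc joining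
`0` and `j` puts `-j` in the block, which replaces `0` as a third nonzero element. -/
theorem isBPoor_iff {s : Finset ℤ} {Λ : Finpartition s} (hΛ : IsSigned Λ) :
    IsBPoor Λ ↔ IsPoorArcs True (arcs Λ) := by
  constructor
  · rintro h ⟨i, j⟩ hij ⟨j', k⟩ hjk (rfl : j = j')
    refine ⟨trivial, ?_⟩
    by_contra hj0
    change j ≠ 0 at hj0
    obtain ⟨h1, b, hb, hib, hjb, -⟩ := mem_arcs_iff.1 hij
    have h2 := (mem_arcs_iff.1 hjk).1
    have hkb := mem_of_arc_left hb hjk hjb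
    have key : ∀ p ∈ b, ∀ q ∈ b, ∀ r ∈ b, p ≠ 0 → q ≠ 0 → r ≠ 0 → p ≠ q → p ≠ r → q ≠ r →
        False := fun p hp q hq r hr hp0 hq0 hr0 hpq hpr hqr =>
      absurd (h b hb) (two_lt_card.2 ⟨p, mem_erase.2 ⟨hp0, hp⟩, q, mem_erase.2 ⟨hq0, hq⟩, r,
        mem_erase.2 ⟨hr0, hr⟩, hpq, hpr, hqr⟩).not_ge
    by_cases hi0 : i = 0
    · have hnj : -j ∈ b := mem_of_arc_right hb (hΛ _ hij).1 (by simpa [hi0] using hib)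
      exact key _ hnj j hjb k hkb (by omega) hj0 (by omega) (by omega) (by omega) (by omega)
    · by_cases hk0 : k = 0
      · have hnj : -j ∈ b := mem_of_arc_left hb (hΛ _ hjk).1 (by simpa [hk0] using hkb)
        exact key i hib j hjb _ hnj hi0 hj0 (by omega) (by omega) (by omega) (by omega)
      · exact key i hib j hjb k hkb hi0 hj0 hk0 h1.ne (h1.trans h2).ne h2.ne
  · intro h b hb
    by_contra hlt
    obtain ⟨i, -, j, hj, k, -, hij, hjk⟩ :=
      exists_consecutive_arcs hb (erase_subset 0 b) (not_le.1 hlt)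
    exact ne_of_mem_erase hj (h _ hij _ hjk rfl).2

theorem motzkinB_eq (x : R) (n : ℕ) : motzkinB n x = (ncOp x ^ n) (fun _ _ => 1) 0 0 := by
  classical
  have h := sum_poorArcSets isTower_groundB False x n fun _ _ => 1
  rw [card_paired_groundB_zero.1, if_neg fun h => h.1] at h
  rw [← h, motzkinB, sum_filter, ncB, piB, filter_filter, poorArcSets,
    sum_filter (s := ncArcSets _), ← sum_weaklyNoncrossing]
  simp only [mul_one]
  exact sum_congr rfl fun Λ _ => if_congr (isPoor_iff Λ) rfl rfl

theorem bMotzkinB_eq (x : R) (n : ℕ) : bMotzkinB n x = (ncOp x ^ n) (fun _ _ => 1) 0 1 := by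
  classical
  have h := sum_poorArcSets isTower_groundB True x n fun _ _ => 1
  rw [card_paired_groundB_zero.1, if_pos ⟨trivial, by simp [groundB]⟩] at h
  rw [← h, bMotzkinB, sum_filter, ncB, piB, filter_filter, poorArcSets,
    sum_filter (s := ncArcSets _), ← sum_weaklyNoncrossing]
  simp only [mul_one]
  exact sum_congr rfl fun Λ hΛ => if_congr (isBPoor_iff (mem_filter.1 hΛ).2.1) rfl rfl

/-! ### Lattice walks and their closed forms. -/

/-- The step operator of lattice walks on the nonnegative integers ending at `0`. -/
def walkOp (x : R) : Module.End R (ℕ → ℕ → R) where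
  toFun g h e := g (h + 1) e + (if h = 0 then 0 else x * g (h - 1) e) +
    (if h = 0 then e * (x * g 0 0) else 0) + if h = 1 then x * g 0 0 else 0
  map_add' g k := by
    ext h e
    simp only [Pi.add_apply]
    split_ifs <;> ring
  map_smul' c g := by
    ext h e
    simp only [Pi.smul_apply, smul_eq_mul, RingHom.id_apply]
    split_ifs <;> ring

theorem walkOp_zero (x : R) (g : ℕ → ℕ → R) (e : ℕ) :
    walkOp x g 0 e = g 1 e + e * (x * g 0 0) := by
  simp [walkOp]

theorem walkOp_one (x : R) (g : ℕ → ℕ → R) (e : ℕ) :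
    walkOp x g 1 e = g 2 e + x * g 0 e + x * g 0 0 := by
  simp [walkOp]

theorem walkOp_add_two (x : R) (g : ℕ → ℕ → R) (h e : ℕ) :
    walkOp x g (h + 2) e = g (h + 3) e + x * g (h + 1) e := by
  simp [walkOp]

theorem binomTransform_delta_one (c : R) (v : ℕ) :
    binomTransform (fun h => if h = 1 then c else 0) v = v * c := by
  rcases v with _ | v <;> simp [binomTransform]

/-- Pascal's rule turns the shift into an up step plus the identity, the hockey-stick identity turns
the sum over `u < v` into a down step, and `v` and the constant `e` are the transforms of point
masses at `1` and `0`: hence the two exceptional steps of `walkOp` at the bottom. -/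
theorem ncOp_binomTransform (x : R) (g : ℕ → ℕ → R) :
    ncOp x (binomTransform₂ g) = binomTransform₂ ((walkOp x + (1 : R) • 1) g) := by
  ext v e
  have h1 := binomTransform_succ (fun h => g h e) v
  have h2 := sum_range_binomTransform (fun h => g h e) v
  have h3 := binomTransform_delta (e * (x * g 0 0) : R) v
  have h4 := binomTransform_delta_one (x * g 0 0 : R) v
  have h5 : binomTransform₂ ((walkOp x + (1 : R) • 1) g) v e =
      binomTransform (fun h => g h e) v + binomTransform (fun h => g (h + 1) e) v
        + x * binomTransform (fun h => if h = 0 then 0 else g (h - 1) e) v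
        + binomTransform (fun h => if h = 0 then (e * (x * g 0 0) : R) else 0) v
        + binomTransform (fun h => if h = 1 then (x * g 0 0 : R) else 0) v := by
    simp only [binomTransform₂, binomTransform, mul_sum, ← sum_add_distrib]
    refine sum_congr rfl fun h _ => ?_
    simp only [LinearMap.add_apply, Module.End.one_apply, Pi.add_apply, one_smul, walkOp,
      LinearMap.coe_mk, AddHom.coe_mk]
    split_ifs <;> ring
  rw [ncOp_apply, h5, ← h1, ← h2, h3, h4]
  simp only [binomTransform₂, binomTransform_zero]
  ring

theorem ncOp_pow_eq_sum (x y : R) (n e : ℕ) :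
    ((ncOp x + y • 1) ^ n) (fun _ _ => 1) 0 e =
      ∑ k ∈ range (n + 1), (n.choose k : R) * ((ncOp x ^ k) fun _ _ => 1) 0 e * y ^ (n - k) := by
  rw [pow_add_smul_apply]
  simp only [Finset.sum_apply, Pi.smul_apply, smul_eq_mul]
  exact sum_congr rfl fun k _ => by ring

theorem ncOp_pow_eq_sum_walkOp (x y : R) (n e : ℕ) :
    ((ncOp x + y • 1) ^ n) (fun _ _ => 1) 0 e =
      ∑ k ∈ range (n + 1), (n.choose k : R) * ((walkOp x ^ k) deltaLeft) 0 e *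
        (y + 1) ^ (n - k) := by
  have h := pow_add_smul_intertwine (P := ncOp x) (Q := walkOp x + (1 : R) • 1)
    (ψ := binomTransform₂) (fun g h => by ext s r; exact congrFun (binomTransform_add _ _) s)
    (fun c g => by ext s r; exact congrFun (binomTransform_smul _ _) s)
    (ncOp_binomTransform x) y n deltaLeft
  rw [binomTransform₂_deltaLeft] at h
  rw [h, binomTransform₂, binomTransform_zero, add_assoc, ← add_smul, pow_add_smul_apply]
  simp only [Finset.sum_apply, Pi.smul_apply, smul_eq_mul]
  exact sum_congr rfl fun k _ => by ring

/-- For `e = 0` every step from `1` to `0` weighs `2 * x`, which amounts to choosing the side of `0`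
for each excursion, so the walks become unrestricted walks on `ℤ` and give binomial coefficients.
The three clauses are heights of the right parity, of the wrong parity, and out of reach; they must
be proved together, by Pascal's rule, since for `e = 1` the steps into `(0, 0)` mix the two
families. -/
theorem walkOp_pow_deltaLeft (x : R) (m : ℕ) :
    (∀ h k, m = h + 2 * k →
      (walkOp x ^ m) deltaLeft h 0 = (if h = 0 then 1 else 2) * (m.choose k : R) * x ^ (h + k) ∧
      (walkOp x ^ m) deltaLeft h 1 = (if h = 0 then 1 else 2) * (m.choose k : R) * x ^ (h + k)) ∧
    (∀ h k, m = h + 1 + 2 * k → (walkOp x ^ m) deltaLeft h 0 = 0 ∧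
      (walkOp x ^ m) deltaLeft h 1 = (m.choose k : R) * x ^ (h + 1 + k)) ∧
    ∀ h, m < h → (walkOp x ^ m) deltaLeft h 0 = 0 ∧ (walkOp x ^ m) deltaLeft h 1 = 0 := by
  induction m with
  | zero =>
    refine ⟨fun h k hk => ?_, fun h k hk => by omega, fun h hh => ?_⟩
    · obtain ⟨rfl, rfl⟩ : h = 0 ∧ k = 0 := by omega
      simp [deltaLeft]
    · simp [deltaLeft, hh.ne']
  | succ m ih =>
    rw [pow_succ', Module.End.mul_apply]
    generalize (walkOp x ^ m) deltaLeft = g at ih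
    obtain ⟨ih1, ih2, ih3⟩ := ih
    have ih1' : ∀ h k, m = h + 1 + 2 * k → g (h + 1) 0 = 2 * (m.choose k : R) * x ^ (h + 1 + k) ∧
        g (h + 1) 1 = 2 * (m.choose k : R) * x ^ (h + 1 + k) := fun h k hk => by
      simpa using ih1 (h + 1) k hk
    have ih1₀ : ∀ k, m = 2 * k → g 0 0 = (m.choose k : R) * x ^ k ∧
        g 0 1 = (m.choose k : R) * x ^ k := fun k hk => by
      simpa using ih1 0 k (by omega)
    have hsum : ∀ k, ((m + 1).choose (k + 1) : R) = m.choose k + m.choose (k + 1) := fun k => by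
      rw [Nat.choose_succ_succ, Nat.cast_add]
    refine ⟨?_, ?_, ?_⟩
    · rintro (_ | _ | h) k hk
      · obtain ⟨k, rfl⟩ : ∃ l, k = l + 1 := ⟨k - 1, by omega⟩
        obtain rfl : m = 0 + 1 + 2 * k := by omega
        obtain ⟨p1, q1⟩ := ih1' 0 k rfl
        obtain ⟨p0, -⟩ := ih2 0 k rfl
        -- At height `0` the factor `2` of height `1` supplies both terms of Pascal's rule, as the
        -- two middle coefficients of an odd row agree.
        have hsymm : ((0 + 1 + 2 * k).choose (k + 1) : R) = (0 + 1 + 2 * k).choose k := by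
          rw [show 0 + 1 + 2 * k = 2 * k + 1 by ring, Nat.choose_symm_half]
        rw [walkOp_zero, walkOp_zero, p1, q1, p0, hsum, hsymm]
        constructor <;> simp <;> ring
      · rcases k with _ | k
        · obtain rfl : m = 0 := by omega
          rw [walkOp_one, walkOp_one, (ih3 2 (by omega)).1, (ih3 2 (by omega)).2,
            (ih1₀ 0 rfl).1, (ih1₀ 0 rfl).2]
          constructor <;> simp <;> ring
        · rw [walkOp_one, walkOp_one, (ih1' 1 k (by omega)).1, (ih1' 1 k (by omega)).2,
            (ih1₀ (k + 1) (by omega)).1, (ih1₀ (k + 1) (by omega)).2, hsum]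
          constructor <;> simp <;> ring
      · rw [walkOp_add_two, walkOp_add_two, (ih1' h k (by omega)).1, (ih1' h k (by omega)).2,
          if_neg (by omega)]
        rcases k with _ | k
        · rw [(ih3 (h + 3) (by omega)).1, (ih3 (h + 3) (by omega)).2]
          constructor <;> simp <;> ring
        · rw [(ih1' (h + 2) k (by omega)).1, (ih1' (h + 2) k (by omega)).2, hsum]
          constructor <;> ring
    · rintro (_ | _ | h) k hk
      · obtain ⟨p0, -⟩ := ih1₀ k (by omega)
        rw [walkOp_zero, walkOp_zero, p0]
        rcases k with _ | k
        · rw [(ih3 1 (by omega)).1, (ih3 1 (by omega)).2]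
          constructor <;> simp
        · rw [(ih2 1 k (by omega)).1, (ih2 1 k (by omega)).2, hsum]
          exact ⟨by simp, by simp; ring⟩
      · obtain ⟨p0, q0⟩ := ih2 0 k (by omega)
        rw [walkOp_one, walkOp_one, p0, q0]
        rcases k with _ | k
        · rw [(ih3 2 (by omega)).1, (ih3 2 (by omega)).2]
          exact ⟨by simp, by simp; ring⟩
        · rw [(ih2 2 k (by omega)).1, (ih2 2 k (by omega)).2, hsum]
          exact ⟨by simp, by simp; ring⟩
      · rw [walkOp_add_two, walkOp_add_two, (ih2 (h + 1) k (by omega)).1,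
          (ih2 (h + 1) k (by omega)).2]
        rcases k with _ | k
        · rw [(ih3 (h + 3) (by omega)).1, (ih3 (h + 3) (by omega)).2]
          exact ⟨by simp, by simp; ring⟩
        · rw [(ih2 (h + 3) k (by omega)).1, (ih2 (h + 3) k (by omega)).2, hsum]
          constructor <;> ring
    · rintro (_ | _ | h) hh
      · omega
      · omega
      · rw [walkOp_add_two, walkOp_add_two, (ih3 (h + 3) (by omega)).1,
          (ih3 (h + 3) (by omega)).2, (ih3 (h + 1) (by omega)).1, (ih3 (h + 1) (by omega)).2]
        constructor <;> ring

theorem walkOp_pow_even (x : R) (k : ℕ) :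
    (walkOp x ^ (2 * k)) deltaLeft 0 0 = ((2 * k).choose k : R) * x ^ k := by
  simpa using ((walkOp_pow_deltaLeft x (2 * k)).1 0 k (by omega)).1

theorem walkOp_pow_odd (x : R) (k : ℕ) : (walkOp x ^ (2 * k + 1)) deltaLeft 0 0 = 0 :=
  ((walkOp_pow_deltaLeft x (2 * k + 1)).2.1 0 k (by omega)).1

theorem walkOp_pow_start_one (x : R) (m : ℕ) :
    (walkOp x ^ m) deltaLeft 0 1 = (m.choose (m / 2) : R) * x ^ ((m + 1) / 2) := by
  rcases Nat.even_or_odd' m with ⟨k, rfl | rfl⟩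
  · rw [show 2 * k / 2 = k by omega, show (2 * k + 1) / 2 = k by omega]
    simpa using ((walkOp_pow_deltaLeft x (2 * k)).1 0 k (by omega)).2
  · rw [show (2 * k + 1) / 2 = k by omega, show (2 * k + 1 + 1) / 2 = 0 + 1 + k by omega]
    exact ((walkOp_pow_deltaLeft x (2 * k + 1)).2.1 0 k (by omega)).2

/-! ### Even-index sums and Riordan's identity. -/

theorem sum_range_two_mul (F : ℕ → R) (n : ℕ) :
    ∑ m ∈ range (2 * n), F m = ∑ k ∈ range n, (F (2 * k) + F (2 * k + 1)) := by
  induction n with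
  | zero => simp
  | succ n ih =>
    rw [mul_add, mul_one, sum_range_succ, sum_range_succ, ih, sum_range_succ, add_assoc]

theorem sum_range_choose_even (F : ℕ → R) (n : ℕ) (hF : ∀ k, F (2 * k + 1) = 0) :
    ∑ m ∈ range (n + 1), (n.choose m : R) * F m =
      ∑ k ∈ range (n + 1), (n.choose (2 * k) : R) * F (2 * k) := by
  have h := sum_range_two_mul (fun m => (n.choose m : R) * F m) (n + 1)
  simp only [hF, mul_zero, add_zero] at h
  rw [← h]
  refine sum_subset (range_mono (by omega)) fun m _ hm => ?_
  rw [mem_range, not_lt] at hm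
  rw [Nat.choose_eq_zero_of_lt (by omega), Nat.cast_zero, zero_mul]

theorem ncOp_pow_eq_sum_choose (x y : R) (n : ℕ) :
    ((ncOp x + y • 1) ^ n) (fun _ _ => 1) 0 0 =
      ∑ k ∈ range (n + 1), ((2 * k).choose k : R) * (n.choose (2 * k) : R) * x ^ k *
        (y + 1) ^ (n - 2 * k) := by
  rw [ncOp_pow_eq_sum_walkOp]
  simp only [mul_assoc]
  rw [sum_range_choose_even (fun m => (walkOp x ^ m) deltaLeft 0 0 * (y + 1) ^ (n - m)) n
    fun k => by rw [walkOp_pow_odd, zero_mul]]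
  refine sum_congr rfl fun k _ => ?_
  rw [walkOp_pow_even]
  ring

open Polynomial in
theorem coeff_C_mul_X_add_one_pow (x : R) (n i : ℕ) :
    ((C x * X + 1 : R[X]) ^ n).coeff i = (n.choose i : R) * x ^ i := by
  have h : ((C x * X + 1 : R[X]) ^ n) =
      ∑ m ∈ range (n + 1), C ((n.choose m : R) * x ^ m) * X ^ m := by
    rw [add_pow]
    refine sum_congr rfl fun m _ => ?_
    rw [mul_pow, one_pow, mul_one, C_mul, C_pow, ← C_eq_natCast]
    simp only [map_natCast]
    ring
  rw [h, finsetSum_coeff]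
  simp only [coeff_C_mul_X_pow, sum_ite_eq, mem_range]
  split_ifs with hi
  · rfl
  · rw [Nat.choose_eq_zero_of_lt (by omega), Nat.cast_zero, zero_mul]

open Polynomial in
theorem coeff_C_mul_X_sq_add_one_pow (x : R) (m : ℕ) :
    (∀ k, m = 2 * k → ((C x * X ^ 2 + 1 : R[X]) ^ m).coeff m = ((2 * k).choose k : R) * x ^ k) ∧
      ∀ k, m = 2 * k + 1 → ((C x * X ^ 2 + 1 : R[X]) ^ m).coeff m = 0 := by
  have h : (C x * X ^ 2 + 1 : R[X]) ^ m = expand R 2 ((C x * X + 1 : R[X]) ^ m) := by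
    simp
  rw [h]
  refine ⟨?_, ?_⟩
  · rintro k rfl
    rw [mul_comm 2 k, coeff_expand_mul two_pos, coeff_C_mul_X_add_one_pow]
  · rintro k rfl
    rw [coeff_expand two_pos, if_neg (by omega)]

open Polynomial in
/-- **Riordan's identity**. -/
theorem sum_choose_sq_mul_pow (x : R) (n : ℕ) :
    ∑ k ∈ range (n + 1), (n.choose k : R) ^ 2 * x ^ k =
      ∑ k ∈ range (n + 1), ((2 * k).choose k : R) * (n.choose (2 * k) : R) * x ^ k *
        (x + 1) ^ (n - 2 * k) := by
  -- Both sides are the coefficient of `X ^ n` in `(1 + xX) ^ n * (1 + X) ^ n`: expand the two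
  -- powers separately, or regroup the product as `((1 + xX²) + (1 + x)X) ^ n`.
  have h1 : ((C x * X + 1 : R[X]) ^ n * (C 1 * X + 1) ^ n).coeff n =
      ∑ k ∈ range (n + 1), (n.choose k : R) ^ 2 * x ^ k := by
    rw [coeff_mul, Nat.sum_antidiagonal_eq_sum_range_succ_mk]
    refine sum_congr rfl fun k hk => ?_
    rw [mem_range] at hk
    rw [coeff_C_mul_X_add_one_pow, coeff_C_mul_X_add_one_pow, Nat.choose_symm (by omega)]
    ring
  have h2 : (C x * X + 1 : R[X]) ^ n * (C 1 * X + 1) ^ n =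
      ∑ m ∈ range (n + 1), C ((n.choose m : R) * (x + 1) ^ (n - m)) *
        ((C x * X ^ 2 + 1) ^ m * X ^ (n - m)) := by
    rw [← mul_pow, show (C x * X + 1 : R[X]) * (C 1 * X + 1) =
      (C x * X ^ 2 + 1) + C (x + 1) * X by rw [C_add, C_1]; ring, add_pow]
    refine sum_congr rfl fun m _ => ?_
    rw [mul_pow, C_mul, C_pow, ← map_natCast (C : R →+* R[X])]
    ring
  rw [← h1, h2, finsetSum_coeff]
  -- The factor `X ^ (n - m)` leaves the coefficient of degree `m` in `(1 + xX²) ^ m`, which is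
  -- central for even `m` and zero for odd `m`.
  have h3 : ∀ m ∈ range (n + 1), (C ((n.choose m : R) * (x + 1) ^ (n - m)) *
      ((C x * X ^ 2 + 1 : R[X]) ^ m * X ^ (n - m))).coeff n =
        (n.choose m : R) * (((C x * X ^ 2 + 1 : R[X]) ^ m).coeff m * (x + 1) ^ (n - m)) := by
    intro m hm
    rw [mem_range] at hm
    rw [coeff_C_mul]
    conv_lhs => rw [show n = m + (n - m) by omega, Nat.add_sub_cancel_left, coeff_mul_X_pow]
    rw [← show n = m + (n - m) by omega]
    ring
  rw [sum_congr rfl h3, sum_range_choose_even (fun m =>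
    ((C x * X ^ 2 + 1 : R[X]) ^ m).coeff m * (x + 1) ^ (n - m)) n
    fun k => by rw [(coeff_C_mul_X_sq_add_one_pow x _).2 k rfl, zero_mul]]
  refine sum_congr rfl fun k _ => ?_
  rw [(coeff_C_mul_X_sq_add_one_pow x _).1 k rfl]
  ring

theorem sum_range_half (x y : R) (n : ℕ) :
    ∑ k ∈ range (n / 2 + 1), ((2 * k).choose k : R) * (n.choose (2 * k) : R) * x ^ k *
        (y + 1) ^ (n - 2 * k) =
      ∑ k ∈ range (n + 1), ((2 * k).choose k : R) * (n.choose (2 * k) : R) * x ^ k *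
        (y + 1) ^ (n - 2 * k) := by
  refine sum_subset (range_mono (by omega)) fun k _ hk => ?_
  rw [mem_range, not_lt] at hk
  rw [Nat.choose_eq_zero_of_lt (show n < 2 * k by omega)]
  simp

end SetPart

end

/-- The four pairs of identities, followed by the specialization `x = y` of the third.
The terms with `n < 2 * k` vanish because of the factor `n.choose (2 * k)`. -/
theorem theorem6p3 {R : Type*} [CommRing R] (n : ℕ) (x y : R) :
    (SetPart.bellB n x y
        = ∑ k ∈ Finset.range (n + 1), (n.choose k : R) * SetPart.bell k (2 * x) * y ^ (n - k) ∧
      SetPart.bellB n x y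
        = ∑ k ∈ Finset.range (n + 1),
            (n.choose k : R) * SetPart.feasible k (2 * x) * (y + 1) ^ (n - k)) ∧
    (SetPart.bellD (n + 1) x y
        = ∑ k ∈ Finset.range (n + 1), (n.choose k : R) * SetPart.bellB k x x * y ^ (n - k) ∧
      SetPart.bellD (n + 1) x y
        = ∑ k ∈ Finset.range (n + 1),
            (n.choose k : R) * SetPart.bFeasibleB k x * (y + 1) ^ (n - k)) ∧
    (SetPart.catB n x y
        = ∑ k ∈ Finset.range (n + 1), (n.choose k : R) * SetPart.motzkinB k x * y ^ (n - k) ∧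
      SetPart.catB n x y
        = ∑ k ∈ Finset.range (n + 1),
            ((2 * k).choose k : R) * (n.choose (2 * k) : R) * x ^ k * (y + 1) ^ (n - 2 * k)) ∧
    (SetPart.catD (n + 1) x y
        = ∑ k ∈ Finset.range (n + 1), (n.choose k : R) * SetPart.bMotzkinB k x * y ^ (n - k) ∧
      SetPart.catD (n + 1) x y
        = ∑ k ∈ Finset.range (n + 1),
            (n.choose k : R) * (k.choose (k / 2) : R) * x ^ ((k + 1) / 2)
              * (y + 1) ^ (n - k)) ∧
    (SetPart.catB n x x = ∑ k ∈ Finset.range (n + 1), (n.choose k : R) ^ 2 * x ^ k ∧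
      ∑ k ∈ Finset.range (n + 1), (n.choose k : R) ^ 2 * x ^ k
        = ∑ k ∈ Finset.range (n / 2 + 1),
            ((2 * k).choose k : R) * (n.choose (2 * k) : R) * x ^ k * (x + 1) ^ (n - 2 * k)) := by
  have hcat := SetPart.ncOp_pow_eq_sum_choose x y n
  refine ⟨⟨?_, ?_⟩, ⟨?_, ?_⟩, ⟨?_, ?_⟩, ⟨?_, ?_⟩, ?_, ?_⟩
  · simp only [SetPart.bellB_eq, SetPart.bell_eq]
    exact SetPart.countOp_pow_eq_sum x y n 0
  · simp only [SetPart.bellB_eq, SetPart.feasible_eq]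
    exact SetPart.countOp_pow_eq_sum_delta x y n 0
  · simp only [SetPart.bellD_eq, SetPart.bellB_diag_eq]
    exact SetPart.countOp_pow_eq_sum x y n 1
  · simp only [SetPart.bellD_eq, SetPart.bFeasibleB_eq]
    exact SetPart.countOp_pow_eq_sum_delta x y n 1
  · simp only [SetPart.catB_eq, SetPart.motzkinB_eq]
    exact SetPart.ncOp_pow_eq_sum x y n 0
  · rw [SetPart.catB_eq, hcat]
  · simp only [SetPart.catD_eq, SetPart.bMotzkinB_eq]
    exact SetPart.ncOp_pow_eq_sum x y n 1
  · rw [SetPart.catD_eq, SetPart.ncOp_pow_eq_sum_walkOp]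
    simp only [SetPart.walkOp_pow_start_one, mul_assoc]
  · rw [SetPart.catB_eq, SetPart.ncOp_pow_eq_sum_choose, SetPart.sum_choose_sq_mul_pow]
  · rw [SetPart.sum_range_half, SetPart.sum_choose_sq_mul_pow]
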